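/- Let $\mathbf M$ and $\mathbf Q$ be small symmetric monoidal categories with the same objects, and let $J:\mathbf M\to\mathbf Q$ be a strong symmetric monoidal functor that is bijective on objects (for instance, strict symmetric monoidal and the identity on objects). Assume that the tensor product of $\mathbf Q$ distributes over the binary coproducts that exist in $\mathbf Q$: for each $X$, the functor $X\otimes -$ preserves all binary coproducts that exist in $\mathbf Q$. Let $\mathcal V=\mathbf{Set}^{2^{\mathrm{op}}}$ be the cartesian closed category of bisets, i.e. of functions $X_1\to X_0$ between sets, with commutative squares as morphisms. Let $\mathbf C$ be the $\mathcal V$-category with the objects of $\mathbf M$ and hom-bisets $J:\mathbf M(A,B)\to\mathbf Q(JA,JB)$, and let $\overline{\mathbf C}=\mathcal V^{\mathbf C^{\mathrm{op}}}$ be its $\mathcal V$-category of presheaves. A presheaf $F\in\overline{\mathbf C}$ amounts to a presheaf of sets $F^0$ on $\mathbf Q$, a presheaf of sets $F^1$ on $\mathbf M$, and a natural map $F^1\to F^0J$. Give $\overline{\mathbf C}$ the Day convolution $\otimes_{\mathrm{Day}}$, with unit $I=\mathbf C(-,I)$. Let $i:\widetilde{\mathbf C}\hookrightarrow\overline{\mathbf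 C}$ be the full $\mathcal V$-subcategory of those $F$ for which $F^0$ takes every binary coproduct that exists in $\mathbf Q$ to a product of sets. Let $\widetilde L:\overline{\mathbf C}\to\widetilde{\mathbf C}$ be the left adjoint of $i$, which replaces $F^0$ by the free product-preserving presheaf on it and keeps $F^1$. Then $\widetilde{\mathbf C}$ is a symmetric monoidal $\mathcal V$-category with $F\otimes G=\widetilde L(iF\otimes_{\mathrm{Day}}iG)$, unit $I$, and the coherence isomorphisms induced by those of $\otimes_{\mathrm{Day}}$. For a biset $X$ and $F\in\overline{\mathbf C}$, let $(X\odot F)(A)=X\times F(A)$. Define $\mathcal V$-functors $p:\mathcal V\to\overline{\mathbf C}$, $p(X)=X\odot I$, and $\flat:\overline{\mathbf C}\to\mathcal V$, $\flat(F)=\overline{\mathbf C}(I,F)$; and $\widetilde p=\widetilde L\circ p:\mathcal V\to\widetilde{\mathbf C}$, so that $\widetilde p(X)=\widetilde L(X\odot I)$, and $\widetilde\flat=\flat\circ i:\widetilde{\mathbf C}\to\mathcal V$, so that $\widetilde\flat(F)=\overline{\mathbf C}(I,iF)$. Then there are $\mathcal V$-adjunctions $p\dashv\flat$ and $\widetilde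 p\dashv\widetilde\flat$, the second of which is the composite of $\widetilde L\dashv i$ and $p\dashv\flat$, that is, given by $$\widetilde{\mathbf C}(\widetilde p X,F)\cong\overline{\mathbf C}(pX,iF)\cong\bigl(X\Rightarrow\widetilde\flat(F)\bigr).$$ Moreover, $\widetilde p$ is a strong (symmetric) monoidal $\mathcal V$-functor from $\mathcal V$ with its cartesian product to $\widetilde{\mathbf C}$ with $\otimes$. -/

import Mathlib

set_option linter.unusedSectionVars false
set_option linter.unusedSimpArgs false
set_option linter.unusedVariables false

open CategoryTheory MonoidalCategory Opposite Limits

universe u v w u₁ u₂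

namespace DynLift


/-! ### Enriched notions over a symmetric monoidal category -/

section Enriched

variable (V : Type v) [Category.{w} V] [MonoidalCategory V]

/-- Composition of maps `X → Y → Z` in a `V`-category, a map `X → Y` being a morphism
`𝟙_ V ⟶ (X ⟶[V] Y)`. -/
def ucomp {A : Type u₁} [EnrichedCategory V A] {X Y Z : A}
    (f : 𝟙_ V ⟶ (X ⟶[V] Y)) (g : 𝟙_ V ⟶ (Y ⟶[V] Z)) : 𝟙_ V ⟶ (X ⟶[V] Z) :=
  (λ_ (𝟙_ V)).inv ≫ (f ⊗ₘ g) ≫ eComp V X Y Z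

/-- Precomposition with a map `X → Y`, as a morphism of hom-objects. -/
def ePre {A : Type u₁} [EnrichedCategory V A] {X Y : A}
    (f : 𝟙_ V ⟶ (X ⟶[V] Y)) (Z : A) : (Y ⟶[V] Z) ⟶ (X ⟶[V] Z) :=
  (λ_ _).inv ≫ (f ▷ _) ≫ eComp V X Y Z

/-- Postcomposition with a map `Y → Z`, as a morphism of hom-objects. -/
def ePost {A : Type u₁} [EnrichedCategory V A] (X : A) {Y Z : A}
    (g : 𝟙_ V ⟶ (Y ⟶[V] Z)) : (X ⟶[V] Y) ⟶ (X ⟶[V] Z) :=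
  (ρ_ _).inv ≫ (_ ◁ g) ≫ eComp V X Y Z

/-- Isomorphisms in a `V`-category. -/
structure VIso {A : Type u₁} [EnrichedCategory V A] (X Y : A) where
  hom : 𝟙_ V ⟶ (X ⟶[V] Y)
  inv : 𝟙_ V ⟶ (Y ⟶[V] X)
  hom_inv : ucomp V hom inv = eId V X
  inv_hom : ucomp V inv hom = eId V Y

/-- A `V`-adjunction `F ⊣ G`: isomorphisms of hom-objects `B(F X, Y) ≅ A(X, G Y)`,
`V`-natural in `Y` and in `X`. -/
structure VAdjunction {A : Type u₁} [EnrichedCategory V A] {B : Type u₂} [EnrichedCategory V B]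
    (F : EnrichedFunctor V A B) (G : EnrichedFunctor V B A) where
  homIso : ∀ (X : A) (Y : B), (F.obj X ⟶[V] Y) ≅ (X ⟶[V] G.obj Y)
  natural_right : ∀ (X : A) (Y Y' : B),
    eComp V (F.obj X) Y Y' ≫ (homIso X Y').hom =
      ((homIso X Y).hom ⊗ₘ G.map Y Y') ≫ eComp V X (G.obj Y) (G.obj Y')
  natural_left : ∀ (X' X : A) (Y : B),
    (F.map X' X ▷ _) ≫ eComp V (F.obj X') (F.obj X) Y ≫ (homIso X' Y).hom =
      (_ ◁ (homIso X Y).hom) ≫ eComp V X' X (G.obj Y)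

variable [SymmetricCategory V]

/-- A symmetric monoidal `V`-category. -/
class SymMonoidalVCat (A : Type u₁) [EnrichedCategory V A] where
  /-- the tensor unit -/
  I : A
  /-- the tensor product of objects -/
  ten : A → A → A
  /-- the action of the tensor product on hom-objects -/
  tenHom : ∀ A₁ B₁ A₂ B₂ : A, (A₁ ⟶[V] B₁) ⊗ (A₂ ⟶[V] B₂) ⟶ (ten A₁ A₂ ⟶[V] ten B₁ B₂)
  tenHom_id : ∀ X Y : A,
    (λ_ (𝟙_ V)).inv ≫ (eId V X ⊗ₘ eId V Y) ≫ tenHom X X Y Y = eId V (ten X Y)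
  tenHom_comp : ∀ A₁ B₁ C₁ A₂ B₂ C₂ : A,
    tensorμ (A₁ ⟶[V] B₁) (A₂ ⟶[V] B₂) (B₁ ⟶[V] C₁) (B₂ ⟶[V] C₂) ≫
        (eComp V A₁ B₁ C₁ ⊗ₘ eComp V A₂ B₂ C₂) ≫ tenHom A₁ C₁ A₂ C₂ =
      (tenHom A₁ B₁ A₂ B₂ ⊗ₘ tenHom B₁ C₁ B₂ C₂) ≫
        eComp V (ten A₁ A₂) (ten B₁ B₂) (ten C₁ C₂)
  /-- the associator -/
  assoc : ∀ X Y Z : A, VIso V (ten (ten X Y) Z) (ten X (ten Y Z))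
  /-- the left unitor -/
  lu : ∀ X : A, VIso V (ten I X) X
  /-- the right unitor -/
  ru : ∀ X : A, VIso V (ten X I) X
  /-- the symmetry -/
  braid : ∀ X Y : A, VIso V (ten X Y) (ten Y X)
  assoc_natural : ∀ A₁ B₁ A₂ B₂ A₃ B₃ : A,
    (tenHom A₁ B₁ A₂ B₂ ▷ (A₃ ⟶[V] B₃)) ≫ tenHom (ten A₁ A₂) (ten B₁ B₂) A₃ B₃ ≫
        ePost V (ten (ten A₁ A₂) A₃) (assoc B₁ B₂ B₃).hom =
      (α_ _ _ _).hom ≫ ((A₁ ⟶[V] B₁) ◁ tenHom A₂ B₂ A₃ B₃) ≫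
        tenHom A₁ B₁ (ten A₂ A₃) (ten B₂ B₃) ≫
          ePre V (assoc A₁ A₂ A₃).hom (ten B₁ (ten B₂ B₃))
  lu_natural : ∀ X Y : A,
    (λ_ _).inv ≫ (eId V I ▷ _) ≫ tenHom I I X Y ≫ ePost V (ten I X) (lu Y).hom =
      ePre V (lu X).hom Y
  ru_natural : ∀ X Y : A,
    (ρ_ _).inv ≫ (_ ◁ eId V I) ≫ tenHom X Y I I ≫ ePost V (ten X I) (ru Y).hom =
      ePre V (ru X).hom Y
  braid_natural : ∀ A₁ B₁ A₂ B₂ : A,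
    tenHom A₁ B₁ A₂ B₂ ≫ ePost V (ten A₁ A₂) (braid B₁ B₂).hom =
      (β_ _ _).hom ≫ tenHom A₂ B₂ A₁ B₁ ≫ ePre V (braid A₁ A₂).hom (ten B₂ B₁)
  pentagon : ∀ W X Y Z : A,
    ucomp V (ucomp V
        ((λ_ (𝟙_ V)).inv ≫ ((assoc W X Y).hom ⊗ₘ eId V Z) ≫ tenHom _ _ _ _)
        (assoc W (ten X Y) Z).hom)
        ((λ_ (𝟙_ V)).inv ≫ (eId V W ⊗ₘ (assoc X Y Z).hom) ≫ tenHom _ _ _ _) =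
      ucomp V (assoc (ten W X) Y Z).hom (assoc W X (ten Y Z)).hom
  triangle : ∀ X Y : A,
    ucomp V (assoc X I Y).hom
        ((λ_ (𝟙_ V)).inv ≫ (eId V X ⊗ₘ (lu Y).hom) ≫ tenHom _ _ _ _) =
      (λ_ (𝟙_ V)).inv ≫ ((ru X).hom ⊗ₘ eId V Y) ≫ tenHom _ _ _ _
  hexagon : ∀ X Y Z : A,
    ucomp V (ucomp V (assoc X Y Z).hom (braid X (ten Y Z)).hom) (assoc Y Z X).hom =
      ucomp V (ucomp V
        ((λ_ (𝟙_ V)).inv ≫ ((braid X Y).hom ⊗ₘ eId V Z) ≫ tenHom _ _ _ _)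
        (assoc Y X Z).hom)
        ((λ_ (𝟙_ V)).inv ≫ (eId V Y ⊗ₘ (braid X Z).hom) ≫ tenHom _ _ _ _)
  symmetry : ∀ X Y : A, ucomp V (braid X Y).hom (braid Y X).hom = eId V (ten X Y)

/-- The tensor product of two maps in a symmetric monoidal `V`-category. -/
def utensor {A : Type u₁} [EnrichedCategory V A] [SymMonoidalVCat V A] {A₁ B₁ A₂ B₂ : A}
    (f : 𝟙_ V ⟶ (A₁ ⟶[V] B₁)) (g : 𝟙_ V ⟶ (A₂ ⟶[V] B₂)) :
    𝟙_ V ⟶ (SymMonoidalVCat.ten V A₁ A₂ ⟶[V] SymMonoidalVCat.ten V B₁ B₂) :=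
  (λ_ (𝟙_ V)).inv ≫ (f ⊗ₘ g) ≫ SymMonoidalVCat.tenHom A₁ B₁ A₂ B₂

open SymMonoidalVCat in
/-- A strong (symmetric) monoidal structure on a `V`-functor. -/
structure StrongMonoidal {A : Type u₁} [EnrichedCategory V A] [SymMonoidalVCat V A]
    {B : Type u₂} [EnrichedCategory V B] [SymMonoidalVCat V B] (F : EnrichedFunctor V A B) where
  ε : VIso V (I V : B) (F.obj (I V))
  μ : ∀ X Y : A, VIso V (ten V (F.obj X) (F.obj Y)) (F.obj (ten V X Y))
  μ_natural : ∀ X X' Y Y' : A,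
    (F.map X X' ⊗ₘ F.map Y Y') ≫ tenHom _ _ _ _ ≫ ePost V _ (μ X' Y').hom =
      tenHom X X' Y Y' ≫ F.map (ten V X Y) (ten V X' Y') ≫ ePre V (μ X Y).hom _
  associativity : ∀ X Y Z : A,
    ucomp V (ucomp V (utensor V (μ X Y).hom (eId V (F.obj Z))) (μ (ten V X Y) Z).hom)
        ((assoc X Y Z).hom ≫ F.map _ _) =
      ucomp V (ucomp V (assoc (F.obj X) (F.obj Y) (F.obj Z)).hom
        (utensor V (eId V (F.obj X)) (μ Y Z).hom)) (μ X (ten V Y Z)).hom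
  left_unitality : ∀ X : A,
    (lu (F.obj X)).hom =
      ucomp V (ucomp V (utensor V ε.hom (eId V (F.obj X))) (μ (I V) X).hom)
        ((lu X).hom ≫ F.map _ _)
  right_unitality : ∀ X : A,
    (ru (F.obj X)).hom =
      ucomp V (ucomp V (utensor V (eId V (F.obj X)) ε.hom) (μ X (I V)).hom)
        ((ru X).hom ≫ F.map _ _)
  braided : ∀ X Y : A,
    ucomp V (μ X Y).hom ((braid X Y).hom ≫ F.map _ _) =
      ucomp V (braid (F.obj X) (F.obj Y)).hom (μ Y X).hom

end Enriched

/-! ### Bisets -/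

/-- A biset: a function `str : one → zero` between two sets. -/
structure Biset : Type (u + 1) where
  zero : Type u
  one : Type u
  str : one → zero

namespace Biset

/-- A morphism of bisets: a commutative square. -/
@[ext]
structure Hom (X Y : Biset.{u}) : Type u where
  app0 : X.zero → Y.zero
  app1 : X.one → Y.one
  comm : ∀ x, Y.str (app1 x) = app0 (X.str x)

instance : Category Biset.{u} where
  Hom := Hom
  id X := ⟨id, id, fun _ => rfl⟩
  comp f g := ⟨g.app0 ∘ f.app0, g.app1 ∘ f.app1, fun x => by simp [g.comm, f.comm]⟩

@[ext] theorem hom_ext {X Y : Biset.{u}} {f g : X ⟶ Y} (h0 : ∀ x, f.app0 x = g.app0 x)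
    (h1 : ∀ x, f.app1 x = g.app1 x) : f = g :=
  Hom.ext (funext h0) (funext h1)

@[simp] theorem id_app0 (X : Biset.{u}) (x : X.zero) : Hom.app0 (𝟙 X) x = x := rfl
@[simp] theorem id_app1 (X : Biset.{u}) (x : X.one) : Hom.app1 (𝟙 X) x = x := rfl
@[simp] theorem comp_app0 {X Y Z : Biset.{u}} (f : X ⟶ Y) (g : Y ⟶ Z) (x : X.zero) :
    (f ≫ g).app0 x = g.app0 (f.app0 x) := rfl
@[simp] theorem comp_app1 {X Y Z : Biset.{u}} (f : X ⟶ Y) (g : Y ⟶ Z) (x : X.one) :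
    (f ≫ g).app1 x = g.app1 (f.app1 x) := rfl

/-- Isomorphisms of bisets from inverse pairs of functions. -/
def mkIso {X Y : Biset.{u}} (f : X ⟶ Y) (g : Y ⟶ X)
    (h : f ≫ g = 𝟙 X) (h' : g ≫ f = 𝟙 Y) : X ≅ Y := ⟨f, g, h, h'⟩

/-- Bisets with their cartesian product. -/
instance : MonoidalCategory Biset.{u} where
  tensorObj X Y := ⟨X.zero × Y.zero, X.one × Y.one, Prod.map X.str Y.str⟩
  tensorHom f g := ⟨Prod.map f.app0 g.app0, Prod.map f.app1 g.app1, fun x => by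
    simp [Prod.map, f.comm, g.comm]⟩
  whiskerLeft X _ _ g := ⟨Prod.map id g.app0, Prod.map id g.app1, fun x => by
    simp [Prod.map, g.comm]⟩
  whiskerRight f Y := ⟨Prod.map f.app0 id, Prod.map f.app1 id, fun x => by
    simp [Prod.map, f.comm]⟩
  tensorUnit := ⟨PUnit, PUnit, id⟩
  associator X Y Z := mkIso
    ⟨fun x => (x.1.1, x.1.2, x.2), fun x => (x.1.1, x.1.2, x.2), fun _ => rfl⟩
    ⟨fun x => ((x.1, x.2.1), x.2.2), fun x => ((x.1, x.2.1), x.2.2), fun _ => rfl⟩ rfl rfl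
  leftUnitor X := mkIso ⟨fun x => x.2, fun x => x.2, fun _ => rfl⟩
    ⟨fun x => (⟨⟩, x), fun x => (⟨⟩, x), fun _ => rfl⟩ rfl rfl
  rightUnitor X := mkIso ⟨fun x => x.1, fun x => x.1, fun _ => rfl⟩
    ⟨fun x => (x, ⟨⟩), fun x => (x, ⟨⟩), fun _ => rfl⟩ rfl rfl

instance : SymmetricCategory Biset.{u} where
  braiding X Y := mkIso ⟨Prod.swap, Prod.swap, fun _ => rfl⟩
    ⟨Prod.swap, Prod.swap, fun _ => rfl⟩ rfl rfl

/-- The category of bisets enriched over itself: the hom-object is the exponential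
`X ⇒ Y`, consisting of the functions `X₀ → Y₀` and the biset morphisms `X ⟶ Y`. -/
instance : EnrichedCategory Biset.{u} Biset.{u} where
  Hom X Y := ⟨X.zero → Y.zero, X ⟶ Y, fun f => f.app0⟩
  id X := ⟨fun _ => id, fun _ => 𝟙 X, fun _ => rfl⟩
  comp X Y Z := ⟨fun p => p.2 ∘ p.1, fun p => p.1 ≫ p.2, fun _ => rfl⟩
  id_comp _ _ := rfl
  comp_id _ _ := rfl
  assoc _ _ _ _ := rfl

end Biset


/-! ### Presheaves of sets and Day convolution -/

/-- A contravariant set-valued functor on a small category. -/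
structure Psh (K : Type u) [SmallCategory K] : Type (u + 1) where
  obj : K → Type u
  map : ∀ {A B : K}, (A ⟶ B) → obj B → obj A
  map_id : ∀ {A : K} (x : obj A), map (𝟙 A) x = x
  map_comp : ∀ {A B C : K} (f : A ⟶ B) (g : B ⟶ C) (x : obj C), map (f ≫ g) x = map f (map g x)

namespace Psh

section
variable {K : Type u} [SmallCategory K]

attribute [simp] Psh.map_id

/-- A natural transformation between presheaves. -/
@[ext]
structure Hom (F G : Psh K) : Type u where
  app : ∀ A : K, F.obj A → G.obj A
  nat : ∀ {A B : K} (f : A ⟶ B) (x : F.obj B), app A (F.map f x) = G.map f (app B x)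

instance : Category (Psh K) where
  Hom := Hom
  id F := ⟨fun _ x => x, fun _ _ => rfl⟩
  comp f g := ⟨fun A x => g.app A (f.app A x), fun h x => by rw [f.nat, g.nat]⟩

@[ext] theorem hom_ext {F G : Psh K} {f g : F ⟶ G} (h : ∀ A x, f.app A x = g.app A x) : f = g :=
  Hom.ext (funext fun A => funext (h A))

@[simp] theorem id_app (F : Psh K) (A : K) (x : F.obj A) : Hom.app (𝟙 F) A x = x := rfl
@[simp] theorem comp_app {F G H : Psh K} (f : F ⟶ G) (g : G ⟶ H) (A : K) (x : F.obj A) :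
    (f ≫ g).app A x = g.app A (f.app A x) := rfl

/-- The representable presheaf on `B`. -/
def rep (B : K) : Psh K where
  obj A := A ⟶ B
  map f g := f ≫ g
  map_id _ := Category.id_comp _
  map_comp _ _ _ := Category.assoc _ _ _

/-- An element of a representable presheaf, as a morphism. -/
def toHom {A B : K} (i : (rep B).obj A) : A ⟶ B := i

/-- A morphism, as an element of a representable presheaf. -/
def ofHom {A B : K} (f : A ⟶ B) : (rep B).obj A := f

@[simp] theorem toHom_map {A A' B : K} (f : A' ⟶ A) (i : (rep B).obj A) :
    toHom ((rep B).map f i) = f ≫ toHom i := rfl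

@[simp] theorem toHom_ofHom {A B : K} (f : A ⟶ B) : toHom (ofHom f) = f := rfl

theorem rep_eq {B A : K} (i : (rep B).obj A) : i = (rep B).map (toHom i) (ofHom (𝟙 B)) :=
  (Category.comp_id i).symm

end

section
variable {K K' : Type u} [SmallCategory K] [SmallCategory K'] (P : K ⥤ K')

/-- Restriction of presheaves along `P`. -/
def res : Psh K' ⥤ Psh K where
  obj F := ⟨fun A => F.obj (P.obj A), fun f => F.map (P.map f),
    fun x => by rw [P.map_id, F.map_id], fun f g x => by rw [P.map_comp, F.map_comp]⟩
  map α := ⟨fun A => α.app (P.obj A), fun f x => α.nat (P.map f) x⟩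

theorem res_map_app {F G : Psh K'} (α : F ⟶ G) (A : K) (x : F.obj (P.obj A)) :
    ((res P).map α).app A x = α.app (P.obj A) x := rfl

end

section Day
variable {K : Type u} [SmallCategory K] [MonoidalCategory K]

/-- An element of the coproduct of the sets `K(D, a ⊗ b) × F a × G b` over all `a`, `b`. -/
structure DayGen (F G : Psh K) (D : K) : Type u where
  a : K
  b : K
  hom : D ⟶ a ⊗ b
  left : F.obj a
  right : G.obj b

/-- The relation that defines the coend of `K(D, a ⊗ b) × F a × G b` over `a`, `b`. -/
inductive DayRel (F G : Psh K) (D : K) : DayGen F G D → DayGen F G D → Prop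
  | glue {a a' b b' : K} (p : a ⟶ a') (q : b ⟶ b') (f : D ⟶ a ⊗ b)
      (x : F.obj a') (y : G.obj b') :
      DayRel F G D ⟨a, b, f, F.map p x, G.map q y⟩ ⟨a', b', f ≫ (p ⊗ₘ q), x, y⟩

/-- The Day convolution of two presheaves. -/
def day (F G : Psh K) : Psh K where
  obj D := Quot (DayRel F G D)
  map h := Quot.lift (fun t => Quot.mk _ ⟨t.a, t.b, h ≫ t.hom, t.left, t.right⟩) (by
    rintro _ _ ⟨p, q, f, x, y⟩
    simpa using Quot.sound (DayRel.glue p q (h ≫ f) x y))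
  map_id := by rintro _ ⟨t⟩; simp
  map_comp := by rintro _ _ _ f g ⟨t⟩; simp

/-- The class of a generator. -/
def dmk {F G : Psh K} {D a b : K} (f : D ⟶ a ⊗ b) (x : F.obj a) (y : G.obj b) :
    (day F G).obj D := Quot.mk _ ⟨a, b, f, x, y⟩

theorem dmk_ind {F G : Psh K} {D : K} {P : (day F G).obj D → Prop}
    (h : ∀ {a b : K} (f : D ⟶ a ⊗ b) (x : F.obj a) (y : G.obj b), P (dmk f x y)) :
    ∀ t, P t := by
  rintro ⟨t⟩; exact h t.hom t.left t.right

theorem dmk_glue {F G : Psh K} {D a a' b b' : K} (p : a ⟶ a') (q : b ⟶ b') (f : D ⟶ a ⊗ b)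
    (x : F.obj a') (y : G.obj b') :
    dmk f (F.map p x) (G.map q y) = dmk (f ≫ (p ⊗ₘ q)) x y :=
  Quot.sound (DayRel.glue p q f x y)

theorem dmk_glue_left {F G : Psh K} {D a a' b : K} (p : a ⟶ a') (f : D ⟶ a ⊗ b)
    (x : F.obj a') (y : G.obj b) : dmk f (F.map p x) y = dmk (f ≫ p ▷ b) x y := by
  simpa using dmk_glue p (𝟙 b) f x y

theorem dmk_glue_right {F G : Psh K} {D a b b' : K} (q : b ⟶ b') (f : D ⟶ a ⊗ b)
    (x : F.obj a) (y : G.obj b') : dmk f x (G.map q y) = dmk (f ≫ a ◁ q) x y := by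
  simpa using dmk_glue (𝟙 a) q f x y

@[simp] theorem day_map_dmk {F G : Psh K} {D D' a b : K} (h : D' ⟶ D) (f : D ⟶ a ⊗ b)
    (x : F.obj a) (y : G.obj b) : (day F G).map h (dmk f x y) = dmk (h ≫ f) x y := rfl

/-- A family of maps `F a × G b → T (a ⊗ b)`, natural in `a` and `b`. -/
@[ext]
structure Bil (F G T : Psh K) : Type u where
  app : ∀ {a b : K}, F.obj a → G.obj b → T.obj (a ⊗ b)
  nat : ∀ {a a' b b' : K} (p : a ⟶ a') (q : b ⟶ b') (x : F.obj a') (y : G.obj b'),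
    app (F.map p x) (G.map q y) = T.map (p ⊗ₘ q) (app x y)

/-- The map out of the Day convolution that corresponds to a natural family. -/
def dayDesc {F G T : Psh K} (φ : Bil F G T) : day F G ⟶ T where
  app D := Quot.lift (fun t => T.map t.hom (φ.app t.left t.right)) (by
    rintro _ _ ⟨p, q, f, x, y⟩
    simp [φ.nat, T.map_comp])
  nat h t := by
    obtain ⟨t⟩ := t
    exact T.map_comp _ _ _

@[simp] theorem dayDesc_dmk {F G T : Psh K} (φ : Bil F G T) {D a b : K} (f : D ⟶ a ⊗ b)
    (x : F.obj a) (y : G.obj b) :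
    (dayDesc φ).app D (dmk f x y) = T.map f (φ.app x y) := rfl

theorem day_hom_ext {F G T : Psh K} {φ ψ : day F G ⟶ T}
    (h : ∀ {a b : K} (x : F.obj a) (y : G.obj b),
      φ.app (a ⊗ b) (dmk (𝟙 _) x y) = ψ.app (a ⊗ b) (dmk (𝟙 _) x y)) : φ = ψ := by
  ext D t
  induction t using dmk_ind with
  | h f x y =>
    have e : (dmk f x y : (day F G).obj D) = (day F G).map f (dmk (𝟙 _) x y) := by simp
    rw [e, φ.nat, ψ.nat, h]

/-- The action of Day convolution on natural transformations. -/
def dayMap {F F' G G' : Psh K} (α : F ⟶ F') (β : G ⟶ G') : day F G ⟶ day F' G' :=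
  dayDesc ⟨fun x y => dmk (𝟙 _) (α.app _ x) (β.app _ y), fun p q x y => by
    simp [α.nat, β.nat, dmk_glue]⟩

@[simp] theorem dayMap_dmk {F F' G G' : Psh K} (α : F ⟶ F') (β : G ⟶ G') {D a b : K}
    (f : D ⟶ a ⊗ b) (x : F.obj a) (y : G.obj b) :
    (dayMap α β).app D (dmk f x y) = dmk f (α.app _ x) (β.app _ y) := by
  simp [dayMap]

/-- The associativity map of Day convolution. -/
def dayAssoc (F G H : Psh K) : day (day F G) H ⟶ day F (day G H) :=
  dayDesc ⟨fun {a c} u z => Quot.lift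
      (fun t => dmk (F := F) (G := day G H) (t.hom ▷ c ≫ (α_ t.a t.b c).hom) t.left
        (dmk (𝟙 _) t.right z)) (by
        rintro _ _ ⟨p, q, f, x, y⟩
        simp only
        rw [dmk_glue_left]
        have e : (dmk (𝟙 _) (G.map q y) z : (day G H).obj _) =
          (day G H).map (q ▷ c) (dmk (𝟙 _) y z) := by simp [dmk_glue_left]
        rw [e, dmk_glue_right]
        congr 1
        simp [MonoidalCategory.tensorHom_def]) u, by
    rintro a a' c c' p q ⟨t⟩ z
    simp only [day]
    change dmk (F := F) (G := day G H) ((p ≫ t.hom) ▷ c ≫ (α_ t.a t.b c).hom) t.left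
        (dmk (𝟙 _) t.right (H.map q z)) = dmk (F := F) (G := day G H)
          ((p ⊗ₘ q) ≫ t.hom ▷ c' ≫ (α_ t.a t.b c').hom) t.left (dmk (𝟙 _) t.right z)
    have e : (dmk (𝟙 _) t.right (H.map q z) : (day G H).obj _) =
          (day G H).map (t.b ◁ q) (dmk (𝟙 _) t.right z) := by simp [dmk_glue_right]
    rw [e, dmk_glue_right]
    congr 1
    simp [tensorHom_def', whisker_exchange_assoc]⟩

@[simp] theorem dayAssoc_dmk {F G H : Psh K} {D e a b c : K} (g : D ⟶ e ⊗ c) (f : e ⟶ a ⊗ b)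
    (x : F.obj a) (y : G.obj b) (z : H.obj c) :
    (dayAssoc F G H).app D (dmk g (dmk f x y) z) =
      dmk (g ≫ f ▷ c ≫ (α_ a b c).hom) x (dmk (𝟙 _) y z) := rfl

/-- The inverse of the associativity map. -/
def dayAssocInv (F G H : Psh K) : day F (day G H) ⟶ day (day F G) H :=
  dayDesc ⟨fun {a c} x u => Quot.lift
      (fun t => dmk (F := day F G) (G := H) (a ◁ t.hom ≫ (α_ a t.a t.b).inv)
        (dmk (𝟙 _) x t.left) t.right) (by
        rintro _ _ ⟨p, q, f, y, z⟩
        simp only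
        rw [dmk_glue_right]
        have e : (dmk (𝟙 _) x (G.map p y) : (day F G).obj _) =
          (day F G).map (a ◁ p) (dmk (𝟙 _) x y) := by simp [dmk_glue_right]
        rw [e, dmk_glue_left]
        congr 1
        simp [tensorHom_def']) u, by
    rintro a a' c c' p q x ⟨t⟩
    simp only [day]
    change dmk (F := day F G) (G := H) (a ◁ (q ≫ t.hom) ≫ (α_ a t.a t.b).inv)
        (dmk (𝟙 _) (F.map p x) t.left) t.right = dmk (F := day F G) (G := H)
          ((p ⊗ₘ q) ≫ a' ◁ t.hom ≫ (α_ a' t.a t.b).inv) (dmk (𝟙 _) x t.left) t.right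
    have e : (dmk (𝟙 _) (F.map p x) t.left : (day F G).obj _) =
          (day F G).map (p ▷ t.a) (dmk (𝟙 _) x t.left) := by simp [dmk_glue_left]
    rw [e, dmk_glue_left]
    congr 1
    simp [MonoidalCategory.tensorHom_def, ← whisker_exchange_assoc]⟩

@[simp] theorem dayAssocInv_dmk {F G H : Psh K} {D e a b c : K} (g : D ⟶ a ⊗ e)
    (f : e ⟶ b ⊗ c) (x : F.obj a) (y : G.obj b) (z : H.obj c) :
    (dayAssocInv F G H).app D (dmk g x (dmk f y z)) =
      dmk (g ≫ a ◁ f ≫ (α_ a b c).inv) (dmk (𝟙 _) x y) z := rfl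

theorem day_hom_ext_left {F G H T : Psh K} {φ ψ : day (day F G) H ⟶ T}
    (h : ∀ {a b c : K} (x : F.obj a) (y : G.obj b) (z : H.obj c),
      φ.app ((a ⊗ b) ⊗ c) (dmk (𝟙 _) (dmk (𝟙 _) x y) z) =
        ψ.app ((a ⊗ b) ⊗ c) (dmk (𝟙 _) (dmk (𝟙 _) x y) z)) : φ = ψ := by
  refine day_hom_ext fun {e c} u z => ?_
  induction u using dmk_ind with
  | @h a b f x y =>
    have e : (dmk (𝟙 _) (dmk f x y) z : (day (day F G) H).obj _) =
        (day (day F G) H).map (f ▷ c) (dmk (𝟙 _) (dmk (𝟙 _) x y) z) := by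
      have := dmk_glue_left (F := day F G) (G := H) f (𝟙 (e ⊗ c)) (dmk (𝟙 _) x y) z
      simpa using this
    rw [e, φ.nat, ψ.nat, h]

theorem day_hom_ext_right {F G H T : Psh K} {φ ψ : day F (day G H) ⟶ T}
    (h : ∀ {a b c : K} (x : F.obj a) (y : G.obj b) (z : H.obj c),
      φ.app (a ⊗ b ⊗ c) (dmk (𝟙 _) x (dmk (𝟙 _) y z)) =
        ψ.app (a ⊗ b ⊗ c) (dmk (𝟙 _) x (dmk (𝟙 _) y z))) : φ = ψ := by
  refine day_hom_ext fun {a e} x u => ?_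
  induction u using dmk_ind with
  | @h b c f y z =>
    have e : (dmk (𝟙 _) x (dmk f y z) : (day F (day G H)).obj _) =
        (day F (day G H)).map (a ◁ f) (dmk (𝟙 _) x (dmk (𝟙 _) y z)) := by
      have := dmk_glue_right (F := F) (G := day G H) f (𝟙 (a ⊗ e)) x (dmk (𝟙 _) y z)
      simpa using this
    rw [e, φ.nat, ψ.nat, h]

/-- `dmk` with an inner generator in normal form. -/
theorem dmk_dmk_right {F G H : Psh K} {D a e b c : K} (g : D ⟶ a ⊗ e) (f : e ⟶ b ⊗ c)
    (x : F.obj a) (y : G.obj b) (z : H.obj c) :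
    (dmk g x (dmk f y z) : (day F (day G H)).obj D) =
      dmk (g ≫ a ◁ f) x (dmk (𝟙 _) y z) := by
  have := dmk_glue_right (F := F) (G := day G H) f g x (dmk (𝟙 _) y z)
  simpa using this

theorem dmk_dmk_left {F G H : Psh K} {D a e b c : K} (g : D ⟶ e ⊗ c) (f : e ⟶ a ⊗ b)
    (x : F.obj a) (y : G.obj b) (z : H.obj c) :
    (dmk g (dmk f x y) z : (day (day F G) H).obj D) =
      dmk (g ≫ f ▷ c) (dmk (𝟙 _) x y) z := by
  have := dmk_glue_left (F := day F G) (G := H) f g (dmk (𝟙 _) x y) z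
  simpa using this

/-- The left unit map of Day convolution. -/
def dayLeft (F : Psh K) : day (rep (𝟙_ K)) F ⟶ F :=
  dayDesc ⟨fun {_ b} i x => F.map (toHom i ▷ b ≫ (λ_ b).hom) x, fun {a a' b b'} p q i x => by
    rw [← F.map_comp, ← F.map_comp]
    congr 1
    simp [MonoidalCategory.tensorHom_def, whisker_exchange_assoc]⟩

@[simp] theorem dayLeft_dmk {F : Psh K} {D a b : K} (f : D ⟶ a ⊗ b)
    (i : (rep (𝟙_ K)).obj a) (x : F.obj b) :
    (dayLeft F).app D (dmk f i x) = F.map (f ≫ toHom i ▷ b ≫ (λ_ b).hom) x :=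
  (F.map_comp _ _ _).symm

/-- The right unit map of Day convolution. -/
def dayRight (F : Psh K) : day F (rep (𝟙_ K)) ⟶ F :=
  dayDesc ⟨fun {a _} x i => F.map (a ◁ toHom i ≫ (ρ_ a).hom) x, fun {a a' b b'} p q x i => by
    rw [← F.map_comp, ← F.map_comp]
    congr 1
    simp [MonoidalCategory.tensorHom_def', ← whisker_exchange_assoc]⟩

@[simp] theorem dayRight_dmk {F : Psh K} {D a b : K} (f : D ⟶ a ⊗ b)
    (x : F.obj a) (i : (rep (𝟙_ K)).obj b) :
    (dayRight F).app D (dmk f x i) = F.map (f ≫ a ◁ toHom i ≫ (ρ_ a).hom) x :=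
  (F.map_comp _ _ _).symm

theorem dayPentagon (W X Y Z : Psh K) :
    dayMap (dayAssoc W X Y) (𝟙 Z) ≫ dayAssoc W (day X Y) Z ≫ dayMap (𝟙 W) (dayAssoc X Y Z) =
      dayAssoc (day W X) Y Z ≫ dayAssoc W X (day Y Z) := by
  refine day_hom_ext fun {e d} u z => ?_
  induction u using dmk_ind with
  | @h e' c f u y =>
    induction u using dmk_ind with
    | @h a b g w x =>
      simp only [comp_app, dayMap_dmk, dayAssoc_dmk, id_app]
      rw [dmk_dmk_right]
      simp

instance : MonoidalCategoryStruct (Psh K) where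
  tensorObj := day
  tensorHom := dayMap
  whiskerLeft F _ _ g := dayMap (𝟙 F) g
  whiskerRight f G := dayMap f (𝟙 G)
  tensorUnit := rep (𝟙_ K)
  associator F G H := ⟨dayAssoc F G H, dayAssocInv F G H,
    day_hom_ext_left fun x y z => by simp, day_hom_ext_right fun x y z => by simp⟩
  leftUnitor F := ⟨dayLeft F,
    ⟨fun b x => dmk (λ_ b).inv (ofHom (𝟙 (𝟙_ K))) x,
      fun {a b} f x => by simp [dmk_glue_right]⟩,
    day_hom_ext fun {a b} i x => by
      rw [comp_app, dayLeft_dmk]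
      simp only [dmk_glue_right]
      conv_rhs => rw [id_app, rep_eq i, dmk_glue_left]
      simp, by ext; simp⟩
  rightUnitor F := ⟨dayRight F,
    ⟨fun b x => dmk (ρ_ b).inv x (ofHom (𝟙 (𝟙_ K))),
      fun {a b} f x => by simp [dmk_glue_left]⟩,
    day_hom_ext fun {a b} x i => by
      rw [comp_app, dayRight_dmk]
      simp only [dmk_glue_left]
      conv_rhs => rw [id_app, rep_eq i, dmk_glue_right]
      simp, by ext; simp⟩

theorem tensorHom_day {F F' G G' : Psh K} (α : F ⟶ F') (β : G ⟶ G') :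
    (α ⊗ₘ β) = dayMap α β := rfl
theorem assoc_day (F G H : Psh K) : (α_ F G H).hom = dayAssoc F G H := rfl
theorem left_day (F : Psh K) : (λ_ F).hom = dayLeft F := rfl
theorem right_day (F : Psh K) : (ρ_ F).hom = dayRight F := rfl

/-- Presheaves with Day convolution form a monoidal category. -/
instance : MonoidalCategory (Psh K) := .ofTensorHom
  (id_tensorHom_id := fun _ _ => day_hom_ext fun _ _ => by
    rw [tensorHom_day, dayMap_dmk]; rfl)
  (id_tensorHom := fun _ _ _ _ => rfl)
  (tensorHom_id := fun _ _ => rfl)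
  (tensorHom_comp_tensorHom := fun _ _ _ _ => day_hom_ext fun _ _ => by
    simp only [tensorHom_day, comp_app, dayMap_dmk])
  (associator_naturality := fun _ _ _ => day_hom_ext_left fun _ _ _ => by
    simp only [tensorHom_day, assoc_day, comp_app]
    erw [dayMap_dmk, dayMap_dmk, dayAssoc_dmk, dayAssoc_dmk, dayMap_dmk, dayMap_dmk])
  (leftUnitor_naturality := fun _ => day_hom_ext fun _ _ => by
    simp only [tensorHom_day, left_day, comp_app, dayMap_dmk]
    erw [dayLeft_dmk, dayLeft_dmk, Hom.nat]; rfl)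
  (rightUnitor_naturality := fun _ => day_hom_ext fun _ _ => by
    simp only [tensorHom_day, right_day, comp_app, dayMap_dmk]
    erw [dayRight_dmk, dayRight_dmk, Hom.nat]; rfl)
  (pentagon := fun W X Y Z => by exact dayPentagon W X Y Z)
  (triangle := fun X Y => by
    refine day_hom_ext_left fun {a b c} x i y => ?_
    simp only [tensorHom_day, assoc_day, left_day, right_day, comp_app]
    erw [dayAssoc_dmk, dayMap_dmk, dayMap_dmk, dayLeft_dmk, dayRight_dmk]
    erw [dmk_glue_left, dmk_glue_right]
    simp)

end Day

section Braid
variable {K : Type u} [SmallCategory K] [MonoidalCategory K] [SymmetricCategory K]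

/-- The symmetry of Day convolution. -/
def dayBraid (F G : Psh K) : day F G ⟶ day G F :=
  dayDesc ⟨fun {a b} x y => dmk (β_ a b).hom y x, fun p q x y => by simp [dmk_glue]⟩

@[simp] theorem dayBraid_dmk {F G : Psh K} {D a b : K} (f : D ⟶ a ⊗ b)
    (x : F.obj a) (y : G.obj b) :
    (dayBraid F G).app D (dmk f x y) = dmk (f ≫ (β_ a b).hom) y x := rfl

theorem dayBraid_comp (F G : Psh K) : dayBraid F G ≫ dayBraid G F = 𝟙 (day F G) :=
  day_hom_ext fun _ _ => by simp

theorem dayBraid_nat {F F' G G' : Psh K} (f : F ⟶ F') (g : G ⟶ G') :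
    dayMap f g ≫ dayBraid F' G' = dayBraid F G ≫ dayMap g f :=
  day_hom_ext fun _ _ => by simp

theorem dayHexagon (F G H : Psh K) :
    dayAssoc F G H ≫ dayBraid F (day G H) ≫ dayAssoc G H F =
      dayMap (dayBraid F G) (𝟙 H) ≫ dayAssoc G F H ≫ dayMap (𝟙 G) (dayBraid F H) :=
  day_hom_ext_left fun x y z => by
    simp only [comp_app, dayMap_dmk, dayAssoc_dmk, dayBraid_dmk, id_app]
    conv_rhs => rw [dmk_dmk_right]
    simp

theorem dayHexagon' (F G H : Psh K) :
    dayAssocInv F G H ≫ dayBraid (day F G) H ≫ dayAssocInv H F G =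
      dayMap (𝟙 F) (dayBraid G H) ≫ dayAssocInv F H G ≫ dayMap (dayBraid F H) (𝟙 G) :=
  day_hom_ext_right fun x y z => by
    simp only [comp_app, dayMap_dmk, dayAssocInv_dmk, dayBraid_dmk, id_app]
    conv_rhs => rw [dmk_dmk_left]
    simp

/-- Day convolution is symmetric. -/
instance : SymmetricCategory (Psh K) where
  braiding F G := ⟨dayBraid F G, dayBraid G F, dayBraid_comp F G, dayBraid_comp G F⟩
  braiding_naturality_left f _ := dayBraid_nat f _
  braiding_naturality_right _ _ _ f := dayBraid_nat _ f
  hexagon_forward F G H := dayHexagon F G H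
  hexagon_reverse F G H := dayHexagon' F G H
  symmetry F G := dayBraid_comp F G

theorem braid_day (F G : Psh K) : (β_ F G).hom = dayBraid F G := rfl

end Braid
end Psh


/-! ### The biset-enriched category `C` and its presheaves -/

section Base
variable {M Q : Type u} [SmallCategory M] [SmallCategory Q]

/-- The objects of the biset-enriched category `C`. -/
def BCat (_J : M ⥤ Q) : Type u := M

/-- The category whose objects are those of `M` and whose morphisms `A ⟶ B` are the morphisms
`J A ⟶ J B` of `Q`. When `J` is bijective on objects, this is a copy of `Q`. -/
abbrev Sem (J : M ⥤ Q) : Type u := InducedCategory Q J.obj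

variable (J : M ⥤ Q)

/-- A morphism `J A ⟶ J B` of `Q`, as a morphism of `Sem J`. -/
abbrev Sem.mk {A B : M} (f : J.obj A ⟶ J.obj B) : (show Sem J from A) ⟶ (show Sem J from B) :=
  ⟨f⟩

/-- The functor `J`, as a functor from `M` to `Sem J`; it is the identity on objects. -/
def toSem : M ⥤ Sem J where
  obj A := A
  map f := Sem.mk J (J.map f)
  map_id A := InducedCategory.hom_ext (J.map_id A)
  map_comp f g := InducedCategory.hom_ext (J.map_comp f g)

/-- The biset-enriched category `C`: its hom-biset from `A` to `B` is
`J : M(A, B) → Q(J A, J B)`. -/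
instance : EnrichedCategory Biset.{u} (BCat J) where
  Hom A B := ⟨J.obj A ⟶ J.obj B, (show M from A) ⟶ (show M from B), fun f => J.map f⟩
  id A := ⟨fun _ => 𝟙 (J.obj A), fun _ => 𝟙 (show M from A), fun _ => J.map_id _⟩
  comp _ _ _ := ⟨fun p => p.1 ≫ p.2, fun p => p.1 ≫ p.2, fun _ => J.map_comp _ _⟩
  id_comp _ _ := Biset.hom_ext (fun _ => Category.id_comp _) (fun _ => Category.id_comp _)
  comp_id _ _ := Biset.hom_ext (fun _ => Category.comp_id _) (fun _ => Category.comp_id _)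
  assoc _ _ _ _ := Biset.hom_ext (fun _ => Category.assoc _ _ _) (fun _ => Category.assoc _ _ _)

/-- The objects of the biset-enriched presheaf category of `C`: the `V`-functors `Cᵒᵖ → V`. -/
abbrev BPsh : Type (u + 1) := EnrichedFunctor Biset.{u} (BCat J)ᵒᵖ Biset.{u}

variable {J}

namespace BPsh

/-- The presheaf of sets `F⁰` on (the copy `Sem J` of) `Q`. -/
def lev0 (F : BPsh J) : Psh (Sem J) where
  obj A := (F.obj (op A)).zero
  map {A B} f x := (F.map (op B) (op A)).app0 f.hom x
  map_id {A} x := congrFun (congrFun (congrArg Biset.Hom.app0 (F.map_id (op A))) ⟨⟩) x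
  map_comp {A B C} f g x := congrFun (congrFun (congrArg Biset.Hom.app0
    (F.map_comp (op C) (op B) (op A))) (g.hom, f.hom)) x

/-- The presheaf of sets `F¹` on `M`. -/
def lev1 (F : BPsh J) : Psh M where
  obj A := (F.obj (op A)).one
  map {A B} f x := ((F.map (op B) (op A)).app1 f).app1 x
  map_id {A} x := congrFun (congrArg Biset.Hom.app1
    (congrFun (congrArg Biset.Hom.app1 (F.map_id (op A))) ⟨⟩)) x
  map_comp {A B C} f g x := congrFun (congrArg Biset.Hom.app1 (congrFun (congrArg Biset.Hom.app1
    (F.map_comp (op C) (op B) (op A))) (g, f))) x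

/-- The map `F¹ A → F⁰ A` of the biset `F A`. -/
def str (F : BPsh J) (A : M) : F.lev1.obj A → F.lev0.obj A := (F.obj (op A)).str

theorem str_nat (F : BPsh J) {A B : M} (f : A ⟶ B) (x : F.lev1.obj B) :
    F.str A (F.lev1.map f x) = F.lev0.map (Sem.mk J (J.map f)) (F.str B x) := by
  refine (((F.map (op B) (op A)).app1 f).comm x).trans ?_
  exact congrFun ((F.map (op B) (op A)).comm f) _

/-- The maps `F¹ A → F⁰ A`, as a natural transformation. -/
def strHom (F : BPsh J) : F.lev1 ⟶ (Psh.res (toSem J)).obj F.lev0 where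
  app := F.str
  nat := F.str_nat

/-- A `V`-functor `Cᵒᵖ → V` from its two levels. -/
def ofLevels (F0 : Psh (Sem J)) (F1 : Psh M) (s : F1 ⟶ (Psh.res (toSem J)).obj F0) :
    BPsh J where
  obj A := ⟨F0.obj A.unop, F1.obj A.unop, s.app A.unop⟩
  map _ _ := ⟨fun f => F0.map (Sem.mk J f), fun f => ⟨F0.map (Sem.mk J (J.map f)), F1.map f,
    fun x => s.nat f x⟩, fun _ => rfl⟩
  map_id A := Biset.hom_ext (fun _ => funext fun x => F0.map_id x) (fun _ => Biset.hom_ext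
    (fun x => Eq.trans (congrArg (fun t => F0.map (Sem.mk J t) x)
      (J.map_id (show M from A.unop))) (F0.map_id x)) fun x => F1.map_id x)
  map_comp A B C := Biset.hom_ext (fun _ => funext fun x => F0.map_comp _ _ x)
    (fun p => Biset.hom_ext (fun x => Eq.trans (congrArg (fun t => F0.map (Sem.mk J t) x)
      (J.map_comp (show (show M from C.unop) ⟶ (show M from B.unop) from p.2)
        (show (show M from B.unop) ⟶ (show M from A.unop) from p.1)))
      (F0.map_comp _ _ x)) fun x => F1.map_comp _ _ x)

/-- A `V`-natural transformation of presheaves: a natural transformation on either level,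
such that the two are compatible. -/
@[ext]
structure Nat (F G : BPsh J) : Type u where
  n0 : F.lev0 ⟶ G.lev0
  n1 : F.lev1 ⟶ G.lev1
  comm : ∀ (A : M) (x : F.lev1.obj A), G.str A (n1.app A x) = n0.app A (F.str A x)

/-- The biset-enriched presheaf category of `C`. The hom-biset from `F` to `G` is the end of
the bisets `F A ⇒ G A`: its lower level consists of the families of functions
`(F A)₀ → (G A)₀` natural with respect to the morphisms of `Q`, its upper level of the
`V`-natural transformations. -/
instance : EnrichedCategory Biset.{u} (BPsh J) where
  Hom F G := ⟨F.lev0 ⟶ G.lev0, Nat F G, Nat.n0⟩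
  id F := ⟨fun _ => 𝟙 F.lev0, fun _ => ⟨𝟙 _, 𝟙 _, fun _ _ => rfl⟩, fun _ => rfl⟩
  comp _ _ _ := ⟨fun p => p.1 ≫ p.2, fun p => ⟨p.1.n0 ≫ p.2.n0, p.1.n1 ≫ p.2.n1,
    fun A x => by rw [Psh.comp_app, Psh.comp_app, p.2.comm, p.1.comm]⟩, fun _ => rfl⟩
  id_comp _ _ := rfl
  comp_id _ _ := rfl
  assoc _ _ _ _ := rfl

end BPsh

/-! ### Smooth presheaves and the reflection -/

variable (J) in
/-- `C` is a coproduct of `A` and `B` in `Q`, with the given injections. -/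
def IsCop {A B C : Sem J} (inl : A ⟶ C) (inr : B ⟶ C) : Prop :=
  Nonempty (IsColimit (BinaryCofan.mk inl.hom inr.hom))

namespace Psh

/-- A presheaf on `Q` that takes binary coproducts of `Q` to products. -/
def PreservesProducts (P : Psh (Sem J)) : Prop :=
  ∀ {A B C : Sem J} (inl : A ⟶ C) (inr : B ⟶ C), IsCop J inl inr →
    Function.Bijective fun x : P.obj C => (P.map inl x, P.map inr x)

theorem rep_preserves (X : Sem J) : (rep X).PreservesProducts := by
  rintro A B C inl inr ⟨h⟩
  constructor
  · intro f g e
    exact InducedCategory.hom_ext (BinaryCofan.IsColimit.hom_ext h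
      (congrArg InducedCategory.Hom.hom (congrArg Prod.fst e))
      (congrArg InducedCategory.Hom.hom (congrArg Prod.snd e)))
  · rintro ⟨f, g⟩
    obtain ⟨l, h₁, h₂⟩ := BinaryCofan.IsColimit.desc' h (toHom f).hom (toHom g).hom
    exact ⟨ofHom ⟨l⟩, Prod.ext (InducedCategory.hom_ext h₁) (InducedCategory.hom_ext h₂)⟩

/-- Terms for the elements of the product-preserving presheaf generated by `P`. -/
inductive Tm (P : Psh (Sem J)) : Sem J → Type u
  | of {A : Sem J} (x : P.obj A) : Tm P A
  | act {A B : Sem J} (f : A ⟶ B) (t : Tm P B) : Tm P A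
  | pair {A B C : Sem J} (inl : A ⟶ C) (inr : B ⟶ C) (h : IsCop J inl inr)
      (s : Tm P A) (t : Tm P B) : Tm P C

/-- The identifications of terms in the product-preserving presheaf generated by `P`. -/
inductive TmRel (P : Psh (Sem J)) : ∀ {A : Sem J}, Tm P A → Tm P A → Prop
  | act_congr {A B : Sem J} (f : A ⟶ B) {t t' : Tm P B} :
      TmRel P t t' → TmRel P (.act f t) (.act f t')
  | pair_congr_left {A B C : Sem J} (inl : A ⟶ C) (inr : B ⟶ C) (h : IsCop J inl inr)
      {s s' : Tm P A} (t : Tm P B) :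
      TmRel P s s' → TmRel P (.pair inl inr h s t) (.pair inl inr h s' t)
  | pair_congr_right {A B C : Sem J} (inl : A ⟶ C) (inr : B ⟶ C) (h : IsCop J inl inr)
      (s : Tm P A) {t t' : Tm P B} :
      TmRel P t t' → TmRel P (.pair inl inr h s t) (.pair inl inr h s t')
  | of_map {A B : Sem J} (f : A ⟶ B) (x : P.obj B) : TmRel P (.of (P.map f x)) (.act f (.of x))
  | act_id {A : Sem J} (t : Tm P A) : TmRel P (.act (𝟙 A) t) t
  | act_comp {A B C : Sem J} (f : A ⟶ B) (g : B ⟶ C) (t : Tm P C) :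
      TmRel P (.act (f ≫ g) t) (.act f (.act g t))
  | pair_inl {A B C : Sem J} (inl : A ⟶ C) (inr : B ⟶ C) (h : IsCop J inl inr)
      (s : Tm P A) (t : Tm P B) : TmRel P (.act inl (.pair inl inr h s t)) s
  | pair_inr {A B C : Sem J} (inl : A ⟶ C) (inr : B ⟶ C) (h : IsCop J inl inr)
      (s : Tm P A) (t : Tm P B) : TmRel P (.act inr (.pair inl inr h s t)) t
  | pair_eta {A B C : Sem J} (inl : A ⟶ C) (inr : B ⟶ C) (h : IsCop J inl inr)
      (t : Tm P C) : TmRel P (.pair inl inr h (.act inl t) (.act inr t)) t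

/-- The free product-preserving presheaf `L P` on a presheaf `P`. -/
def refl (P : Psh (Sem J)) : Psh (Sem J) where
  obj A := Quot (TmRel P (A := A))
  map f := Quot.map (.act f) fun _ _ => .act_congr f
  map_id := by rintro _ ⟨t⟩; exact Quot.sound (.act_id t)
  map_comp := by rintro _ _ _ f g ⟨t⟩; exact Quot.sound (.act_comp f g t)

/-- The unit `η : P → L P`. -/
def unit (P : Psh (Sem J)) : P ⟶ refl P where
  app _ x := Quot.mk _ (.of x)
  nat f x := Quot.sound (.of_map f x)

theorem refl_preserves (P : Psh (Sem J)) : (refl P).PreservesProducts := by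
  intro A B C inl inr h
  constructor
  · rintro ⟨t⟩ ⟨t'⟩ e
    have key : ∀ t : Tm P C, (Quot.mk _ t : (refl P).obj C) =
        Quot.map₂ (.pair inl inr h) (fun s _ _ r => .pair_congr_right inl inr h s r)
          (fun _ _ t r => .pair_congr_left inl inr h t r)
          ((refl P).map inl (Quot.mk _ t)) ((refl P).map inr (Quot.mk _ t)) :=
      fun t => (Quot.sound (.pair_eta inl inr h t)).symm
    have e1 : (refl P).map inl (Quot.mk _ t) = (refl P).map inl (Quot.mk _ t') :=
      congrArg Prod.fst e
    have e2 : (refl P).map inr (Quot.mk _ t) = (refl P).map inr (Quot.mk _ t') :=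
      congrArg Prod.snd e
    rw [key t, key t', e1, e2]
  · rintro ⟨⟨s⟩, ⟨t⟩⟩
    exact ⟨Quot.mk _ (.pair inl inr h s t), Prod.ext (Quot.sound (.pair_inl inl inr h s t))
      (Quot.sound (.pair_inr inl inr h s t))⟩

/-- The value of a term in a product-preserving presheaf. -/
noncomputable def eval {P T : Psh (Sem J)} (hT : T.PreservesProducts) (f : P ⟶ T) :
    ∀ {A : Sem J}, Tm P A → T.obj A
  | _, .of x => f.app _ x
  | _, .act g t => T.map g (eval hT f t)
  | _, .pair inl inr h s t => Function.surjInv (hT inl inr h).2 (eval hT f s, eval hT f t)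

theorem eval_pair {P T : Psh (Sem J)} (hT : T.PreservesProducts) (f : P ⟶ T)
    {A B C : Sem J} (inl : A ⟶ C) (inr : B ⟶ C) (h : IsCop J inl inr) (s : Tm P A) (t : Tm P B) :
    (T.map inl (eval hT f (.pair inl inr h s t)), T.map inr (eval hT f (.pair inl inr h s t))) =
      (eval hT f s, eval hT f t) :=
  Function.surjInv_eq (hT inl inr h).2 _

theorem eval_rel {P T : Psh (Sem J)} (hT : T.PreservesProducts) (f : P ⟶ T) {A : Sem J}
    {t t' : Tm P A} (r : TmRel P t t') : eval hT f t = eval hT f t' := by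
  induction r with
  | act_congr g _ ih => simp only [eval, ih]
  | pair_congr_left _ _ _ _ _ ih => simp only [eval, ih]
  | pair_congr_right _ _ _ _ _ ih => simp only [eval, ih]
  | of_map g x => exact f.nat g x
  | act_id t => exact T.map_id _
  | act_comp g g' t => exact T.map_comp _ _ _
  | pair_inl inl inr h s t => exact (Prod.ext_iff.mp (eval_pair hT f inl inr h s t)).1
  | pair_inr inl inr h s t => exact (Prod.ext_iff.mp (eval_pair hT f inl inr h s t)).2
  | pair_eta inl inr h t => exact (hT inl inr h).1 (eval_pair hT f inl inr h _ _)

/-- The universal property of `L P`: the extension of `f : P → T` to `L P`. -/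
noncomputable def ext {P T : Psh (Sem J)} (hT : T.PreservesProducts) (f : P ⟶ T) :
    refl P ⟶ T where
  app _ := Quot.lift (eval hT f) fun _ _ => eval_rel hT f
  nat := by rintro _ _ g ⟨t⟩; rfl

@[simp] theorem unit_ext {P T : Psh (Sem J)} (hT : T.PreservesProducts) (f : P ⟶ T) :
    unit P ≫ ext hT f = f := rfl

theorem refl_hom_ext {P T : Psh (Sem J)} (hT : T.PreservesProducts) {f g : refl P ⟶ T}
    (h : unit P ≫ f = unit P ≫ g) : f = g := by
  have key : ∀ {A : Sem J} (t : Tm P A), f.app A (Quot.mk _ t) = g.app A (Quot.mk _ t) := by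
   intro A t
   induction t with
   | of x => exact congrFun (congrFun (congrArg Hom.app h) _) x
   | act k t ih =>
     exact (f.nat k (Quot.mk _ t)).trans ((congrArg _ ih).trans (g.nat k (Quot.mk _ t)).symm)
   | pair inl inr hc s t ih ih' =>
     apply (hT inl inr hc).1
     have e1 : (refl P).map inl (Quot.mk _ (.pair inl inr hc s t)) = Quot.mk _ s :=
       Quot.sound (.pair_inl inl inr hc s t)
     have e2 : (refl P).map inr (Quot.mk _ (.pair inl inr hc s t)) = Quot.mk _ t :=
       Quot.sound (.pair_inr inl inr hc s t)
     exact Prod.ext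
       ((f.nat inl _).symm.trans ((congrArg (f.app _) e1).trans
         (ih.trans ((congrArg (g.app _) e1.symm).trans (g.nat inl _)))))
       ((f.nat inr _).symm.trans ((congrArg (f.app _) e2).trans
         (ih'.trans ((congrArg (g.app _) e2.symm).trans (g.nat inr _)))))
  ext A t
  obtain ⟨t⟩ := t
  exact key t

end Psh

variable (J) in
/-- The full `V`-subcategory `C̃` of smooth presheaves. -/
def CTilde : Type (u + 1) := {F : BPsh J // F.lev0.PreservesProducts}

instance : EnrichedCategory Biset.{u} (CTilde J) where
  Hom F G := F.1 ⟶[Biset.{u}] G.1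
  id F := eId Biset.{u} F.1
  comp F G H := eComp Biset.{u} F.1 G.1 H.1
  id_comp _ _ := rfl
  comp_id _ _ := rfl
  assoc _ _ _ _ := rfl

variable (J) in
/-- The inclusion `V`-functor `i` of `C̃` into the presheaf category. -/
def incl : EnrichedFunctor Biset.{u} (CTilde J) (BPsh J) where
  obj F := F.1
  map _ _ := 𝟙 _
  map_id _ := rfl
  map_comp _ _ _ := rfl

variable (J) in
/-- The reflection `V`-functor `L̃`. It sends `F` to the presheaf with lower level `L F⁰`, with
the same upper level as `F`, and with the composites of the maps of `F` with the unit
`F⁰ → L F⁰`. -/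
noncomputable def reflTilde : EnrichedFunctor Biset.{u} (BPsh J) (CTilde J) where
  obj F := ⟨.ofLevels F.lev0.refl F.lev1 (F.strHom ≫ (Psh.res (toSem J)).map F.lev0.unit), F.lev0.refl_preserves⟩
  map F G := ⟨fun α => Psh.ext G.lev0.refl_preserves (α ≫ G.lev0.unit),
    fun α => ⟨Psh.ext G.lev0.refl_preserves (α.n0 ≫ G.lev0.unit), α.n1, fun A x =>
      congrArg (G.lev0.unit.app A) (α.comm A x)⟩, fun _ => rfl⟩
  map_id F := by
    have e : Psh.ext F.lev0.refl_preserves (𝟙 _ ≫ F.lev0.unit) = 𝟙 _ :=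
      Psh.refl_hom_ext F.lev0.refl_preserves rfl
    exact Biset.hom_ext (fun _ => e) (fun _ => BPsh.Nat.ext e rfl)
  map_comp F G H := by
    have e : ∀ (α : F.lev0 ⟶ G.lev0) (β : G.lev0 ⟶ H.lev0),
      Psh.ext H.lev0.refl_preserves ((α ≫ β) ≫ H.lev0.unit) =
        Psh.ext G.lev0.refl_preserves (α ≫ G.lev0.unit) ≫
          Psh.ext H.lev0.refl_preserves (β ≫ H.lev0.unit) :=
      fun α β => Psh.refl_hom_ext H.lev0.refl_preserves rfl
    exact Biset.hom_ext (fun p => e p.1 p.2) (fun p => BPsh.Nat.ext (e p.1.n0 p.2.n0) rfl)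

variable (J) in
/-- The `V`-adjunction `L̃ ⊣ i`. -/
noncomputable def reflAdj : VAdjunction Biset.{u} (reflTilde J) (incl J) where
  homIso F G := Biset.mkIso
    ⟨fun α => F.lev0.unit ≫ α, fun α => ⟨F.lev0.unit ≫ α.n0, α.n1, fun A x => α.comm A x⟩,
      fun _ => rfl⟩
    ⟨fun α => Psh.ext G.2 α, fun α => ⟨Psh.ext G.2 α.n0, α.n1, fun A x => α.comm A x⟩,
      fun _ => rfl⟩
    (Biset.hom_ext (fun _ => Psh.refl_hom_ext G.2 rfl)
      (fun _ => BPsh.Nat.ext (Psh.refl_hom_ext G.2 rfl) rfl)) rfl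
  natural_right _ _ _ := rfl
  natural_left _ _ _ := rfl

end Base


/-! ### The symmetric monoidal structure of `Sem J` -/

section SemMon
variable {M Q : Type u} [SmallCategory M] [MonoidalCategory M] [SymmetricCategory M]
  [SmallCategory Q] [MonoidalCategory Q] [SymmetricCategory Q] (J : M ⥤ Q) [J.Braided]

open Functor.Monoidal Functor.LaxMonoidal Functor.OplaxMonoidal

instance : MonoidalCategoryStruct (Sem J) where
  tensorObj A B := (MonoidalCategoryStruct.tensorObj (C := M) A B : M)
  tensorUnit := (𝟙_ M : M)
  tensorHom {A A' B B'} f g := ⟨δ J A B ≫ (f.hom ⊗ₘ g.hom) ≫ μ J A' B'⟩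
  whiskerLeft A {B B'} g := ⟨δ J A B ≫ (J.obj A ◁ g.hom) ≫ μ J A B'⟩
  whiskerRight {A A'} f B := ⟨δ J A B ≫ (f.hom ▷ J.obj B) ≫ μ J A' B⟩
  associator A B C := InducedCategory.isoMk
    (J.mapIso (MonoidalCategoryStruct.associator (C := M) A B C))
  leftUnitor A := InducedCategory.isoMk (J.mapIso (MonoidalCategoryStruct.leftUnitor (C := M) A))
  rightUnitor A := InducedCategory.isoMk (J.mapIso (MonoidalCategoryStruct.rightUnitor (C := M) A))

/-- The structure of `Sem J` agrees with the one of `Q`. -/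
def Sem.data : Monoidal.InducingFunctorData (inducedFunctor (C := M) (D := Q) J.obj) where
  μIso A B := μIso J A B
  εIso := εIso J
  whiskerLeft_eq _ _ _ _ := rfl
  whiskerRight_eq _ _ := rfl
  tensorHom_eq _ _ := rfl
  associator_eq A B C := (show ∀ A B C : M, J.map (α_ A B C).hom =
    (δ J (A ⊗ B) C ≫ (δ J A B ⊗ₘ 𝟙 _)) ≫ (α_ (J.obj A) (J.obj B) (J.obj C)).hom ≫
      (𝟙 _ ⊗ₘ μ J B C) ≫ μ J A (B ⊗ C) from fun A B C => by simp) A B C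
  leftUnitor_eq A := (show ∀ A : M, J.map (λ_ A).hom =
    (δ J (𝟙_ M) A ≫ (η J ⊗ₘ 𝟙 _)) ≫ (λ_ (J.obj A)).hom from fun A => by simp) A
  rightUnitor_eq A := (show ∀ A : M, J.map (ρ_ A).hom =
    (δ J A (𝟙_ M) ≫ (𝟙 _ ⊗ₘ η J)) ≫ (ρ_ (J.obj A)).hom from fun A => by simp) A

instance : MonoidalCategory (Sem J) := Monoidal.induced _ (Sem.data J)

instance : (inducedFunctor (C := M) (D := Q) J.obj).Monoidal :=
  Monoidal.fromInducedMonoidal _ (Sem.data J)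

instance : BraidedCategory (Sem J) := .ofFaithful (inducedFunctor (C := M) (D := Q) J.obj)
  (fun A B => InducedCategory.isoMk (J.mapIso (BraidedCategory.braiding (C := M) A B)))
  (fun A B => Functor.LaxBraided.braided (F := J) (show M from A) (show M from B))

instance : (inducedFunctor (C := M) (D := Q) J.obj).Braided where
  braided A B := Functor.LaxBraided.braided (F := J) (show M from A) (show M from B)

instance : SymmetricCategory (Sem J) := .ofFaithful (inducedFunctor (C := M) (D := Q) J.obj)

/-- `toSem J` is strictly monoidal. -/
def toSemCore : (toSem J).CoreMonoidal where
  εIso := Iso.refl (𝟙_ (Sem J))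
  μIso A B := Iso.refl (MonoidalCategoryStruct.tensorObj (C := Sem J) A B)
  μIso_hom_natural_left {A B} f C := InducedCategory.hom_ext
    (show (δ J A C ≫ (J.map f ▷ J.obj C) ≫ μ J B C) ≫ 𝟙 _ = 𝟙 _ ≫ J.map (f ▷ C) by simp)
  μIso_hom_natural_right {A B} C f := InducedCategory.hom_ext
    (show (δ J C A ≫ (J.obj C ◁ J.map f) ≫ μ J C B) ≫ 𝟙 _ = 𝟙 _ ≫ J.map (C ◁ f) by simp)
  associativity A B C := InducedCategory.hom_ext
    (show (δ J (A ⊗ B) C ≫ (𝟙 _ ▷ J.obj C) ≫ μ J (A ⊗ B) C) ≫ 𝟙 _ ≫ J.map (α_ A B C).hom =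
      J.map (α_ A B C).hom ≫ (δ J A (B ⊗ C) ≫ (J.obj A ◁ 𝟙 _) ≫ μ J A (B ⊗ C)) ≫ 𝟙 _ by simp)
  left_unitality A := InducedCategory.hom_ext
    (show J.map (λ_ A).hom = (δ J (𝟙_ M) A ≫ (𝟙 _ ▷ J.obj A) ≫ μ J (𝟙_ M) A) ≫ 𝟙 _ ≫
      J.map (λ_ A).hom by simp)
  right_unitality A := InducedCategory.hom_ext
    (show J.map (ρ_ A).hom = (δ J A (𝟙_ M) ≫ (J.obj A ◁ 𝟙 _) ≫ μ J A (𝟙_ M)) ≫ 𝟙 _ ≫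
      J.map (ρ_ A).hom by simp)

instance : (toSem J).Monoidal := (toSemCore J).toMonoidal

instance : (toSem J).Braided where
  braided A B := InducedCategory.hom_ext
    (show 𝟙 _ ≫ J.map (β_ A B).hom = J.map (β_ A B).hom ≫ 𝟙 _ by simp)

end SemMon

/-! ### Restriction of presheaves along a monoidal functor -/

namespace Psh
open Functor.Monoidal Functor.LaxMonoidal Functor.OplaxMonoidal

variable {K K' : Type u} [SmallCategory K] [MonoidalCategory K] [SmallCategory K']
  [MonoidalCategory K'] (P : K ⥤ K') [P.Monoidal]

/-- The comparison between the Day convolution over `K` and the one over `K'`. -/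
def resTensor (F G : Psh K') : day ((res P).obj F) ((res P).obj G) ⟶ (res P).obj (day F G) :=
  dayDesc ⟨fun {a b} x y => dmk (F := F) (G := G) (δ P a b) x y, fun {a a' b b'} p q x y => by
    change dmk (δ P a b) (F.map (P.map p) x) (G.map (P.map q) y) =
      dmk (P.map (p ⊗ₘ q) ≫ δ P a' b') x y
    exact (dmk_glue (F := F) (G := G) (P.map p) (P.map q) (δ P a b) x y).trans
      (congrArg (fun k => dmk (F := F) (G := G) k x y) (δ_natural P p q))⟩

theorem resTensor_dmk {F G : Psh K'} {D a b : K} (f : D ⟶ a ⊗ b) (x : F.obj (P.obj a))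
    (y : G.obj (P.obj b)) :
    (resTensor P F G).app D (dmk f x y) = dmk (F := F) (G := G) (P.map f ≫ δ P a b) x y := rfl

/-- The comparison between the units. -/
def resUnit : rep (𝟙_ K) ⟶ (res P).obj (rep (𝟙_ K')) where
  app _ i := ofHom (P.map (toHom i) ≫ η P)
  nat f i := by
    change ofHom (P.map (f ≫ toHom i) ≫ η P) = ofHom (P.map f ≫ P.map (toHom i) ≫ η P)
    simp

theorem res_nat {F F' G G' : Psh K'} (f : F ⟶ F') (g : G ⟶ G') :
    dayMap ((res P).map f) ((res P).map g) ≫ resTensor P F' G' =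
      resTensor P F G ≫ (res P).map (dayMap f g) :=
  day_hom_ext fun {a b} x y => by
    simp only [comp_app, dayMap_dmk, resTensor_dmk, res_map_app]
    exact (dayMap_dmk (F := F) (G := G) f g (P.map (𝟙 (a ⊗ b)) ≫ δ P a b) x y).symm

theorem res_assoc (F G H : Psh K') :
    dayMap (resTensor P F G) (𝟙 _) ≫ resTensor P (day F G) H ≫ (res P).map (dayAssoc F G H) =
      dayAssoc _ _ _ ≫ dayMap (𝟙 _) (resTensor P G H) ≫ resTensor P F (day G H) := by
  refine day_hom_ext_left fun {a b c} x y z => ?_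
  simp only [comp_app, dayMap_dmk, resTensor_dmk, res_map_app, dayAssoc_dmk]
  change dmk (F := F) (G := day G H)
      ((P.map (𝟙 ((a ⊗ b) ⊗ c)) ≫ δ P (a ⊗ b) c) ≫ (P.map (𝟙 (a ⊗ b)) ≫ δ P a b) ▷ P.obj c ≫
        (α_ _ _ _).hom) x (dmk (𝟙 _) y z) =
    dmk (F := F) (G := day G H) (P.map (𝟙 _ ≫ 𝟙 (a ⊗ b) ▷ c ≫ (α_ a b c).hom) ≫ δ P a (b ⊗ c)) x
      (dmk (P.map (𝟙 _) ≫ δ P b c) y z)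
  refine Eq.trans ?_ (dmk_dmk_right (F := F) (G := G) (H := H) _ _ x y z).symm
  refine congrArg (fun k => dmk (F := F) (G := day G H) k x (dmk (𝟙 _) y z)) ?_
  simp

theorem res_left (F : Psh K') : dayLeft ((res P).obj F) =
    dayMap (resUnit P) (𝟙 _) ≫ resTensor P (rep (𝟙_ K')) F ≫ (res P).map (dayLeft F) := by
  refine day_hom_ext fun {a b} i x => ?_
  simp only [comp_app, dayMap_dmk, resTensor_dmk, res_map_app, dayLeft_dmk]
  change F.map (P.map (𝟙 _ ≫ toHom i ▷ b ≫ (λ_ b).hom)) x =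
    (dayLeft F).app _ (dmk (P.map (𝟙 _) ≫ δ P a b) (ofHom (P.map (toHom i) ≫ η P)) x)
  refine Eq.trans ?_ (dayLeft_dmk (F := F) _ _ x).symm
  refine congrArg (fun k => F.map k x) ?_
  simp

theorem res_right (F : Psh K') : dayRight ((res P).obj F) =
    dayMap (𝟙 _) (resUnit P) ≫ resTensor P F (rep (𝟙_ K')) ≫ (res P).map (dayRight F) := by
  refine day_hom_ext fun {a b} x i => ?_
  simp only [comp_app, dayMap_dmk, resTensor_dmk, res_map_app, dayRight_dmk]
  change F.map (P.map (𝟙 _ ≫ a ◁ toHom i ≫ (ρ_ a).hom)) x =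
    (dayRight F).app _ (dmk (P.map (𝟙 _) ≫ δ P a b) x (ofHom (P.map (toHom i) ≫ η P)))
  refine Eq.trans ?_ (dayRight_dmk (F := F) _ x _).symm
  refine congrArg (fun k => F.map k x) ?_
  simp

/-- Restriction is lax monoidal for Day convolution. -/
instance : (res P).LaxMonoidal where
  ε := resUnit P
  μ := resTensor P
  μ_natural_left f G := res_nat P f (𝟙 G)
  μ_natural_right F g := res_nat P (𝟙 F) g
  associativity F G H := res_assoc P F G H
  left_unitality F := res_left P F
  right_unitality F := res_right P F

end Psh

namespace Psh
open Functor.Monoidal Functor.LaxMonoidal Functor.OplaxMonoidal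
variable {K K' : Type u} [SmallCategory K] [MonoidalCategory K] [SymmetricCategory K]
  [SmallCategory K'] [MonoidalCategory K'] [SymmetricCategory K'] (P : K ⥤ K') [P.Braided]

theorem res_braid (F G : Psh K') :
    resTensor P F G ≫ (res P).map (dayBraid F G) = dayBraid _ _ ≫ resTensor P G F := by
  refine day_hom_ext fun {a b} x y => ?_
  simp only [comp_app, resTensor_dmk, res_map_app, dayBraid_dmk]
  change dmk (F := G) (G := F) ((P.map (𝟙 _) ≫ δ P a b) ≫ (β_ _ _).hom) y x =
    dmk (P.map (𝟙 _ ≫ (β_ a b).hom) ≫ δ P b a) y x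
  refine congrArg (fun k => dmk (F := G) (G := F) k y x) ?_
  simp

instance : (res P).LaxBraided where
  braided F G := res_braid P F G

end Psh


/-! ### Reflections compatible with a symmetric monoidal structure -/

/-- A reflection onto a class `Loc` of objects of a symmetric monoidal category which is
compatible with the tensor product: maps `X ⊗ Z ⟶ T` with `Loc T` extend uniquely to
`L X ⊗ Z ⟶ T`. -/
structure MonRefl (𝒞 : Type v) [Category.{w} 𝒞] [MonoidalCategory 𝒞] where
  Loc : 𝒞 → Prop
  L : 𝒞 → 𝒞
  η : ∀ X, X ⟶ L X
  loc : ∀ X, Loc (L X)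
  loc_unit : Loc (𝟙_ 𝒞)
  ext : ∀ {X T : 𝒞}, Loc T → (X ⟶ T) → (L X ⟶ T)
  fac : ∀ {X T : 𝒞} (hT : Loc T) (f : X ⟶ T), η X ≫ ext hT f = f
  uniq : ∀ {X T : 𝒞} (_ : Loc T) (f g : L X ⟶ T), η X ≫ f = η X ≫ g → f = g
  extR : ∀ {X T : 𝒞} (Z : 𝒞), Loc T → (X ⊗ Z ⟶ T) → (L X ⊗ Z ⟶ T)
  facR : ∀ {X T : 𝒞} (Z : 𝒞) (hT : Loc T) (f : X ⊗ Z ⟶ T), η X ▷ Z ≫ extR Z hT f = f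
  uniqR : ∀ {X T : 𝒞} (Z : 𝒞) (_ : Loc T) (f g : L X ⊗ Z ⟶ T),
    η X ▷ Z ≫ f = η X ▷ Z ≫ g → f = g

namespace MonRefl
variable {𝒞 : Type v} [Category.{w} 𝒞] [MonoidalCategory 𝒞] [SymmetricCategory 𝒞]
  (R : MonRefl 𝒞)

attribute [simp] fac facR

@[simp] theorem fac_assoc {X T T' : 𝒞} (hT : R.Loc T) (f : X ⟶ T) (g : T ⟶ T') :
    R.η X ≫ R.ext hT f ≫ g = f ≫ g := by
  rw [← Category.assoc, R.fac]

@[simp] theorem facR_assoc {X T T' : 𝒞} (Z : 𝒞) (hT : R.Loc T) (f : X ⊗ Z ⟶ T) (g : T ⟶ T') :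
    R.η X ▷ Z ≫ R.extR Z hT f ≫ g = f ≫ g := by
  rw [← Category.assoc, R.facR]

/-- The extension to a reflection in the second variable. -/
def extL {X T : 𝒞} (Z : 𝒞) (hT : R.Loc T) (f : Z ⊗ X ⟶ T) : Z ⊗ R.L X ⟶ T :=
  (β_ _ _).hom ≫ R.extR Z hT ((β_ _ _).hom ≫ f)

@[simp] theorem facL {X T : 𝒞} (Z : 𝒞) (hT : R.Loc T) (f : Z ⊗ X ⟶ T) :
    Z ◁ R.η X ≫ R.extL Z hT f = f := by
  simp [extL]

@[simp] theorem facL_assoc {X T T' : 𝒞} (Z : 𝒞) (hT : R.Loc T) (f : Z ⊗ X ⟶ T) (g : T ⟶ T') :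
    Z ◁ R.η X ≫ R.extL Z hT f ≫ g = f ≫ g := by
  rw [← Category.assoc, R.facL]

theorem uniqL {X T : 𝒞} (Z : 𝒞) (hT : R.Loc T) (f g : Z ⊗ R.L X ⟶ T)
    (h : Z ◁ R.η X ≫ f = Z ◁ R.η X ≫ g) : f = g := by
  have : (β_ (R.L X) Z).hom ≫ f = (β_ (R.L X) Z).hom ≫ g := by
    apply R.uniqR Z hT
    simp [h]
  simpa using this

/-- The tensor product of local objects. -/
def tens (X Y : 𝒞) : 𝒞 := R.L (X ⊗ Y)

/-- The map `X ⊗ Y ⟶ tens X Y`. -/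
def ι (X Y : 𝒞) : X ⊗ Y ⟶ R.tens X Y := R.η (X ⊗ Y)

theorem loc_tens (X Y : 𝒞) : R.Loc (R.tens X Y) := R.loc _

/-- Extension of a map along `ι`. -/
def desc {X Y T : 𝒞} (hT : R.Loc T) (f : X ⊗ Y ⟶ T) : R.tens X Y ⟶ T := R.ext hT f

@[simp] theorem ι_desc {X Y T : 𝒞} (hT : R.Loc T) (f : X ⊗ Y ⟶ T) :
    R.ι X Y ≫ R.desc hT f = f := R.fac hT f

@[simp] theorem ι_desc_assoc {X Y T T' : 𝒞} (hT : R.Loc T) (f : X ⊗ Y ⟶ T) (g : T ⟶ T') :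
    R.ι X Y ≫ R.desc hT f ≫ g = f ≫ g := R.fac_assoc hT f g

theorem tens_uniq {X Y T : 𝒞} (hT : R.Loc T) {f g : R.tens X Y ⟶ T}
    (h : R.ι X Y ≫ f = R.ι X Y ≫ g) : f = g := R.uniq hT f g h

theorem tens_uniqR {X Y Z T : 𝒞} (hT : R.Loc T) {f g : R.tens (R.tens X Y) Z ⟶ T}
    (h : R.ι X Y ▷ Z ≫ R.ι _ _ ≫ f = R.ι X Y ▷ Z ≫ R.ι _ _ ≫ g) : f = g :=
  R.tens_uniq hT (R.uniqR _ hT _ _ h)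

theorem tens_uniqL {X Y Z T : 𝒞} (hT : R.Loc T) {f g : R.tens X (R.tens Y Z) ⟶ T}
    (h : X ◁ R.ι Y Z ≫ R.ι _ _ ≫ f = X ◁ R.ι Y Z ≫ R.ι _ _ ≫ g) : f = g :=
  R.tens_uniq hT (R.uniqL _ hT _ _ h)

theorem tens_uniqRR {W X Y Z T : 𝒞} (hT : R.Loc T)
    {f g : R.tens (R.tens (R.tens W X) Y) Z ⟶ T}
    (h : R.ι W X ▷ Y ▷ Z ≫ R.ι _ Y ▷ Z ≫ R.ι _ _ ≫ f =
      R.ι W X ▷ Y ▷ Z ≫ R.ι _ Y ▷ Z ≫ R.ι _ _ ≫ g) : f = g := by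
  refine R.tens_uniqR hT ?_
  have : (α_ _ _ _).inv ≫ R.ι (R.tens W X) Y ▷ Z ≫ R.ι _ _ ≫ f =
      (α_ _ _ _).inv ≫ R.ι (R.tens W X) Y ▷ Z ≫ R.ι _ _ ≫ g := by
    refine R.uniqR _ hT _ _ ?_
    change R.ι W X ▷ (Y ⊗ Z) ≫ _ = R.ι W X ▷ (Y ⊗ Z) ≫ _
    simp only [whiskerRight_tensor, Category.assoc, Iso.hom_inv_id_assoc, h]
  simpa using this

/-- The tensor product of morphisms. -/
def tensHom {X X' Y Y' : 𝒞} (f : X ⟶ X') (g : Y ⟶ Y') : R.tens X Y ⟶ R.tens X' Y' :=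
  R.ext (R.loc_tens _ _) ((f ⊗ₘ g) ≫ R.ι X' Y')

@[simp] theorem ι_tensHom {X X' Y Y' : 𝒞} (f : X ⟶ X') (g : Y ⟶ Y') :
    R.ι X Y ≫ R.tensHom f g = (f ⊗ₘ g) ≫ R.ι X' Y' := R.fac _ _

@[simp] theorem ι_tensHom_assoc {X X' Y Y' T : 𝒞} (f : X ⟶ X') (g : Y ⟶ Y')
    (k : R.tens X' Y' ⟶ T) :
    R.ι X Y ≫ R.tensHom f g ≫ k = (f ⊗ₘ g) ≫ R.ι X' Y' ≫ k := by
  rw [← Category.assoc, ι_tensHom, Category.assoc]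

theorem tensHom_id (X Y : 𝒞) : R.tensHom (𝟙 X) (𝟙 Y) = 𝟙 _ :=
  R.tens_uniq (R.loc_tens _ _) (by simp)

theorem tensHom_comp {X X' X'' Y Y' Y'' : 𝒞} (f : X ⟶ X') (f' : X' ⟶ X'') (g : Y ⟶ Y')
    (g' : Y' ⟶ Y'') : R.tensHom (f ≫ f') (g ≫ g') = R.tensHom f g ≫ R.tensHom f' g' :=
  R.tens_uniq (R.loc_tens _ _) (by simp)

/-- The associator. -/
def assocHom (X Y Z : 𝒞) : R.tens (R.tens X Y) Z ⟶ R.tens X (R.tens Y Z) :=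
  R.ext (R.loc_tens _ _) (R.extR Z (R.loc_tens _ _) ((α_ X Y Z).hom ≫ X ◁ R.ι Y Z ≫ R.ι _ _))

theorem ι_assocHom (X Y Z : 𝒞) :
    R.ι X Y ▷ Z ≫ R.ι _ _ ≫ R.assocHom X Y Z = (α_ X Y Z).hom ≫ X ◁ R.ι Y Z ≫ R.ι _ _ :=
  (congrArg (R.ι X Y ▷ Z ≫ ·) (R.fac _ _)).trans (R.facR _ _ _)

theorem ι_assocHom_assoc (X Y Z : 𝒞) {T : 𝒞} (k : R.tens X (R.tens Y Z) ⟶ T) :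
    R.ι X Y ▷ Z ≫ R.ι _ _ ≫ R.assocHom X Y Z ≫ k =
      (α_ X Y Z).hom ≫ X ◁ R.ι Y Z ≫ R.ι _ _ ≫ k := by
  have := congrArg (· ≫ k) (R.ι_assocHom X Y Z)
  simpa using this

/-- The inverse of the associator. -/
def assocInv (X Y Z : 𝒞) : R.tens X (R.tens Y Z) ⟶ R.tens (R.tens X Y) Z :=
  R.ext (R.loc_tens _ _) (R.extL X (R.loc_tens _ _) ((α_ X Y Z).inv ≫ R.ι X Y ▷ Z ≫ R.ι _ _))

theorem ι_assocInv (X Y Z : 𝒞) :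
    X ◁ R.ι Y Z ≫ R.ι _ _ ≫ R.assocInv X Y Z = (α_ X Y Z).inv ≫ R.ι X Y ▷ Z ≫ R.ι _ _ :=
  (congrArg (X ◁ R.ι Y Z ≫ ·) (R.fac _ _)).trans (R.facL _ _ _)

theorem ι_assocInv_assoc (X Y Z : 𝒞) {T : 𝒞} (k : R.tens (R.tens X Y) Z ⟶ T) :
    X ◁ R.ι Y Z ≫ R.ι _ _ ≫ R.assocInv X Y Z ≫ k =
      (α_ X Y Z).inv ≫ R.ι X Y ▷ Z ≫ R.ι _ _ ≫ k := by
  have := congrArg (· ≫ k) (R.ι_assocInv X Y Z)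
  simpa using this

/-- The associator, as an isomorphism. -/
@[simps]
def assoc (X Y Z : 𝒞) : R.tens (R.tens X Y) Z ≅ R.tens X (R.tens Y Z) where
  hom := R.assocHom X Y Z
  inv := R.assocInv X Y Z
  hom_inv_id := R.tens_uniqR (R.loc_tens _ _) (by rw [ι_assocHom_assoc, ι_assocInv]; simp)
  inv_hom_id := R.tens_uniqL (R.loc_tens _ _) (by rw [ι_assocInv_assoc, ι_assocHom]; simp)

theorem assoc_naturality {X X' Y Y' Z Z' : 𝒞} (f : X ⟶ X') (g : Y ⟶ Y') (h : Z ⟶ Z') :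
    R.tensHom (R.tensHom f g) h ≫ R.assocHom X' Y' Z' =
      R.assocHom X Y Z ≫ R.tensHom f (R.tensHom g h) := by
  refine R.tens_uniqR (R.loc_tens _ _) ?_
  rw [ι_tensHom_assoc, ι_assocHom_assoc, ι_tensHom, ← tensorHom_id, tensorHom_comp_tensorHom_assoc,
    ι_tensHom, ← id_tensorHom, tensorHom_comp_tensorHom_assoc, ι_tensHom]
  have e : ((f ⊗ₘ g) ≫ R.ι X' Y') ⊗ₘ h = ((f ⊗ₘ g) ⊗ₘ h) ≫ R.ι X' Y' ▷ Z' := by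
    rw [← tensorHom_id, tensorHom_comp_tensorHom, Category.comp_id]
  have e' : (f ⊗ₘ (g ⊗ₘ h) ≫ R.ι Y' Z') = (f ⊗ₘ g ⊗ₘ h) ≫ X' ◁ R.ι Y' Z' := by
    rw [← id_tensorHom, tensorHom_comp_tensorHom, Category.comp_id]
  simp only [Category.id_comp]
  rw [e, e', Category.assoc, Category.assoc, ι_assocHom, associator_naturality_assoc]

theorem pentagon (W X Y Z : 𝒞) :
    R.tensHom (R.assocHom W X Y) (𝟙 Z) ≫ R.assocHom W (R.tens X Y) Z ≫
        R.tensHom (𝟙 W) (R.assocHom X Y Z) =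
      R.assocHom (R.tens W X) Y Z ≫ R.assocHom W X (R.tens Y Z) := by
  refine R.tens_uniqRR (R.loc_tens _ _) ?_
  have l : R.ι W X ▷ Y ▷ Z ≫ R.ι _ Y ▷ Z ≫ R.assocHom W X Y ▷ Z =
      (α_ W X Y).hom ▷ Z ≫ (W ◁ R.ι X Y) ▷ Z ≫ R.ι _ _ ▷ Z := by
    simp only [← comp_whiskerRight, R.ι_assocHom]
  have l' : W ◁ R.ι X Y ▷ Z ≫ W ◁ R.ι _ Z ≫ W ◁ R.assocHom X Y Z =
      W ◁ (α_ X Y Z).hom ≫ W ◁ X ◁ R.ι Y Z ≫ W ◁ R.ι _ _ := by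
    simp only [← whiskerLeft_comp, R.ι_assocHom]
  have l2 : R.ι W X ▷ Y ▷ Z ≫ R.ι _ Y ▷ Z ≫ R.assocHom W X Y ▷ Z ≫ R.ι _ _ ≫
      R.assocHom W (R.tens X Y) Z ≫ R.tensHom (𝟙 W) (R.assocHom X Y Z) =
      ((R.ι W X ▷ Y ▷ Z ≫ R.ι _ Y ▷ Z ≫ R.assocHom W X Y ▷ Z)) ≫ R.ι _ _ ≫
      R.assocHom W (R.tens X Y) Z ≫ R.tensHom (𝟙 W) (R.assocHom X Y Z) := by simp
  rw [ι_tensHom_assoc, MonoidalCategory.tensorHom_id, l2, l, ι_assocHom_assoc]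
  simp only [Category.assoc]
  rw [ι_assocHom_assoc, ι_tensHom, id_tensorHom, associator_naturality_middle_assoc]
  have l3 : W ◁ R.ι X Y ▷ Z ≫ W ◁ R.ι (R.tens X Y) Z ≫ W ◁ R.assocHom X Y Z ≫ R.ι _ _ =
      (W ◁ R.ι X Y ▷ Z ≫ W ◁ R.ι (R.tens X Y) Z ≫ W ◁ R.assocHom X Y Z) ≫ R.ι _ _ := by simp
  rw [l3, l', associator_naturality_left_assoc, ← whisker_exchange_assoc, ι_assocHom]
  simp

/-- The left unitor of a local object. -/
@[simps]
def lu (X : 𝒞) (hX : R.Loc X) : R.tens (𝟙_ 𝒞) X ≅ X where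
  hom := R.desc hX (λ_ X).hom
  inv := (λ_ X).inv ≫ R.ι _ _
  hom_inv_id := R.tens_uniq (R.loc_tens _ _) (by simp)
  inv_hom_id := by simp

/-- The right unitor of a local object. -/
@[simps]
def ru (X : 𝒞) (hX : R.Loc X) : R.tens X (𝟙_ 𝒞) ≅ X where
  hom := R.desc hX (ρ_ X).hom
  inv := (ρ_ X).inv ≫ R.ι _ _
  hom_inv_id := R.tens_uniq (R.loc_tens _ _) (by simp)
  inv_hom_id := by simp

/-- The symmetry. -/
@[simps]
def braid (X Y : 𝒞) : R.tens X Y ≅ R.tens Y X where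
  hom := R.desc (R.loc_tens _ _) ((β_ X Y).hom ≫ R.ι _ _)
  inv := R.desc (R.loc_tens _ _) ((β_ Y X).hom ≫ R.ι _ _)
  hom_inv_id := R.tens_uniq (R.loc_tens _ _) (by simp)
  inv_hom_id := R.tens_uniq (R.loc_tens _ _) (by simp)

@[simp] theorem ι_lu (X : 𝒞) (hX : R.Loc X) : R.ι _ _ ≫ (R.lu X hX).hom = (λ_ X).hom := R.fac _ _
@[simp] theorem ι_ru (X : 𝒞) (hX : R.Loc X) : R.ι _ _ ≫ (R.ru X hX).hom = (ρ_ X).hom := R.fac _ _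
@[simp] theorem ι_braid (X Y : 𝒞) : R.ι _ _ ≫ (R.braid X Y).hom = (β_ X Y).hom ≫ R.ι _ _ :=
  R.fac _ _
@[simp] theorem ι_braid_assoc (X Y : 𝒞) {T : 𝒞} (k : R.tens Y X ⟶ T) :
    R.ι _ _ ≫ (R.braid X Y).hom ≫ k = (β_ X Y).hom ≫ R.ι _ _ ≫ k := by
  simp [braid]

theorem lu_naturality {X Y : 𝒞} (hX : R.Loc X) (hY : R.Loc Y) (f : X ⟶ Y) :
    R.tensHom (𝟙 (𝟙_ 𝒞)) f ≫ (R.lu Y hY).hom = (R.lu X hX).hom ≫ f :=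
  R.tens_uniq hY (by rw [ι_tensHom_assoc, ι_lu, ← Category.assoc, ι_lu]; simp)

theorem ru_naturality {X Y : 𝒞} (hX : R.Loc X) (hY : R.Loc Y) (f : X ⟶ Y) :
    R.tensHom f (𝟙 (𝟙_ 𝒞)) ≫ (R.ru Y hY).hom = (R.ru X hX).hom ≫ f :=
  R.tens_uniq hY (by rw [ι_tensHom_assoc, ι_ru, ← Category.assoc, ι_ru]; simp)

theorem braid_naturality {X X' Y Y' : 𝒞} (f : X ⟶ X') (g : Y ⟶ Y') :
    R.tensHom f g ≫ (R.braid X' Y').hom = (R.braid X Y).hom ≫ R.tensHom g f :=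
  R.tens_uniq (R.loc_tens _ _) (by rw [ι_tensHom_assoc, ι_braid, ι_braid_assoc, ι_tensHom]; simp)

theorem triangle (X Y : 𝒞) (hX : R.Loc X) (hY : R.Loc Y) :
    R.assocHom X (𝟙_ 𝒞) Y ≫ R.tensHom (𝟙 X) (R.lu Y hY).hom =
      R.tensHom (R.ru X hX).hom (𝟙 Y) := by
  refine R.tens_uniqR (R.loc_tens _ _) ?_
  rw [ι_assocHom_assoc, ι_tensHom, ι_tensHom, MonoidalCategory.tensorHom_id, id_tensorHom,
    ← whiskerLeft_comp_assoc, ι_lu, ← comp_whiskerRight_assoc, ι_ru]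
  simp

theorem hexagon (X Y Z : 𝒞) :
    R.assocHom X Y Z ≫ (R.braid X (R.tens Y Z)).hom ≫ R.assocHom Y Z X =
      R.tensHom (R.braid X Y).hom (𝟙 Z) ≫ R.assocHom Y X Z ≫
        R.tensHom (𝟙 Y) (R.braid X Z).hom := by
  refine R.tens_uniqR (R.loc_tens _ _) ?_
  rw [ι_assocHom_assoc, ι_braid_assoc, ι_tensHom_assoc, MonoidalCategory.tensorHom_id,
    ← comp_whiskerRight_assoc, ι_braid, BraidedCategory.braiding_naturality_right_assoc,
    ι_assocHom, comp_whiskerRight_assoc, ι_assocHom_assoc, ι_tensHom, id_tensorHom,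
    ← whiskerLeft_comp_assoc, ι_braid]
  simp

theorem symmetry (X Y : 𝒞) : (R.braid X Y).hom ≫ (R.braid Y X).hom = 𝟙 _ :=
  (R.braid X Y).hom_inv_id

/-! ### Objects over a lax monoidal functor -/

section Lax
variable {𝒟 : Type u₁} [Category.{u₂} 𝒟] [MonoidalCategory 𝒟] [SymmetricCategory 𝒟]
  (S : 𝒞 ⥤ 𝒟) [S.LaxBraided]
open Functor.LaxMonoidal

/-- The tensor product of two morphisms into values of a lax monoidal functor. -/
def tensStr {X Y : 𝒞} {X₁ Y₁ : 𝒟} (s : X₁ ⟶ S.obj X) (t : Y₁ ⟶ S.obj Y) :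
    X₁ ⊗ Y₁ ⟶ S.obj (R.tens X Y) :=
  (s ⊗ₘ t) ≫ μ S X Y ≫ S.map (R.ι X Y)

theorem tensStr_hom {X X' Y Y' : 𝒞} {X₁ X₁' Y₁ Y₁' : 𝒟} {s : X₁ ⟶ S.obj X} {t : Y₁ ⟶ S.obj Y}
    {s' : X₁' ⟶ S.obj X'} {t' : Y₁' ⟶ S.obj Y'} {f : X ⟶ X'} {g : Y ⟶ Y'}
    {f₁ : X₁ ⟶ X₁'} {g₁ : Y₁ ⟶ Y₁'} (hf : f₁ ≫ s' = s ≫ S.map f) (hg : g₁ ≫ t' = t ≫ S.map g) :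
    (f₁ ⊗ₘ g₁) ≫ R.tensStr S s' t' = R.tensStr S s t ≫ S.map (R.tensHom f g) := by
  simp only [tensStr, Category.assoc, ← S.map_comp, ι_tensHom]
  rw [tensorHom_comp_tensorHom_assoc, hf, hg, S.map_comp, ← μ_natural_assoc,
    tensorHom_comp_tensorHom_assoc]

theorem tensStr_assoc {X Y Z : 𝒞} {X₁ Y₁ Z₁ : 𝒟} (s : X₁ ⟶ S.obj X) (t : Y₁ ⟶ S.obj Y)
    (r : Z₁ ⟶ S.obj Z) :
    (α_ X₁ Y₁ Z₁).hom ≫ R.tensStr S s (R.tensStr S t r) =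
      R.tensStr S (R.tensStr S s t) r ≫ S.map (R.assocHom X Y Z) := by
  have h1 : R.tensStr S s (R.tensStr S t r) =
      (s ⊗ₘ (t ⊗ₘ r)) ≫ S.obj X ◁ μ S Y Z ≫ μ S X (Y ⊗ Z) ≫
        S.map (X ◁ R.ι Y Z ≫ R.ι _ _) := by
    rw [S.map_comp, ← μ_natural_right_assoc, tensStr, tensStr, ← id_tensorHom, ← id_tensorHom,
      tensorHom_comp_tensorHom_assoc, tensorHom_comp_tensorHom_assoc]
    simp
  have h2 : R.tensStr S (R.tensStr S s t) r =
      ((s ⊗ₘ t) ⊗ₘ r) ≫ μ S X Y ▷ S.obj Z ≫ μ S (X ⊗ Y) Z ≫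
        S.map (R.ι X Y ▷ Z ≫ R.ι _ _) := by
    rw [S.map_comp, ← μ_natural_left_assoc, tensStr, tensStr, ← MonoidalCategory.tensorHom_id,
      ← MonoidalCategory.tensorHom_id,
      tensorHom_comp_tensorHom_assoc, tensorHom_comp_tensorHom_assoc]
    simp
  rw [h1, h2]
  simp only [Category.assoc, ← S.map_comp, ι_assocHom]
  simp only [S.map_comp]
  rw [Functor.LaxMonoidal.associativity_assoc, associator_naturality_assoc]

theorem tensStr_lu {X : 𝒞} (hX : R.Loc X) {X₁ : 𝒟} (s : X₁ ⟶ S.obj X) :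
    (λ_ X₁).hom ≫ s = R.tensStr S (ε S) s ≫ S.map (R.lu X hX).hom := by
  simp only [tensStr, Category.assoc, ← S.map_comp, ι_lu]
  rw [MonoidalCategory.tensorHom_def', Category.assoc, ← Functor.LaxMonoidal.left_unitality,
    leftUnitor_naturality]

theorem tensStr_ru {X : 𝒞} (hX : R.Loc X) {X₁ : 𝒟} (s : X₁ ⟶ S.obj X) :
    (ρ_ X₁).hom ≫ s = R.tensStr S s (ε S) ≫ S.map (R.ru X hX).hom := by
  simp only [tensStr, Category.assoc, ← S.map_comp, ι_ru]
  rw [MonoidalCategory.tensorHom_def, Category.assoc, ← Functor.LaxMonoidal.right_unitality,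
    rightUnitor_naturality]

theorem tensStr_braid {X Y : 𝒞} {X₁ Y₁ : 𝒟} (s : X₁ ⟶ S.obj X) (t : Y₁ ⟶ S.obj Y) :
    (β_ X₁ Y₁).hom ≫ R.tensStr S t s = R.tensStr S s t ≫ S.map (R.braid X Y).hom := by
  simp only [tensStr, Category.assoc, ← S.map_comp, ι_braid]
  rw [S.map_comp, Functor.LaxBraided.braided_assoc,
    BraidedCategory.braiding_naturality_assoc]

end Lax
end MonRefl


/-! ### The reflection is compatible with Day convolution -/

section MonReflection
variable {M Q : Type u} [SmallCategory M] [MonoidalCategory M] [SymmetricCategory M]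
  [SmallCategory Q] [MonoidalCategory Q] [SymmetricCategory Q] {J : M ⥤ Q} [J.Braided]

open Functor.Monoidal Functor.LaxMonoidal Functor.OplaxMonoidal

theorem isCop_transport {𝒞 : Type u₁} [Category.{u₂} 𝒞] {X Y Z X' Y' Z' : 𝒞} {i : X ⟶ Z} {j : Y ⟶ Z}
    (h : IsColimit (BinaryCofan.mk i j)) (eX : X' ≅ X) (eY : Y' ≅ Y) (eZ : Z' ≅ Z) :
    Nonempty (IsColimit (BinaryCofan.mk (eX.hom ≫ i ≫ eZ.inv) (eY.hom ≫ j ≫ eZ.inv))) := by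
  have hd : ∀ {T : 𝒞} (f : X ⟶ T) (g : Y ⟶ T), ∃ l : Z ⟶ T, i ≫ l = f ∧ j ≫ l = g :=
    fun f g => ⟨_, (BinaryCofan.IsColimit.desc' h f g).2⟩
  have hu : ∀ {T : 𝒞} (l l' : Z ⟶ T), i ≫ l = i ≫ l' → j ≫ l = j ≫ l' → l = l' :=
    fun l l' h₁ h₂ => BinaryCofan.IsColimit.hom_ext h h₁ h₂
  choose d h₁ h₂ using @hd
  refine ⟨BinaryCofan.IsColimit.mk _ (fun f g => eZ.hom ≫ d (eX.inv ≫ f) (eY.inv ≫ g))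
    (fun f g => ?_) (fun f g => ?_) (fun {T} f g m e₁ e₂ => ?_)⟩
  · change (eX.hom ≫ i ≫ eZ.inv) ≫ eZ.hom ≫ d (eX.inv ≫ f) (eY.inv ≫ g) = f
    simp [h₁]
  · change (eY.hom ≫ j ≫ eZ.inv) ≫ eZ.hom ≫ d (eX.inv ≫ f) (eY.inv ≫ g) = g
    simp [h₂]
  · change Z' ⟶ _ at m
    have e₁' : (eX.hom ≫ i ≫ eZ.inv) ≫ m = f := e₁
    have e₂' : (eY.hom ≫ j ≫ eZ.inv) ≫ m = g := e₂
    refine (Iso.inv_comp_eq eZ).mp (hu _ _ ?_ ?_)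
    · rw [h₁, ← e₁']
      simp
    · rw [h₂, ← e₂']
      simp

theorem IsCop.whiskerRight [∀ X : Q, PreservesColimitsOfShape (Discrete WalkingPair) (tensorLeft X)]
    {A B C : Sem J} {inl : A ⟶ C} {inr : B ⟶ C} (h : IsCop J inl inr) (b : Sem J) :
    IsCop J (inl ▷ b) (inr ▷ b) := by
  obtain ⟨h⟩ := h
  have h' := mapIsColimitOfPreservesOfIsColimit (tensorLeft (J.obj b)) inl.hom inr.hom h
  let e (X : M) : J.obj (X ⊗ b) ≅ J.obj b ⊗ J.obj X := (μIso J X b).symm ≪≫ β_ (J.obj X) (J.obj b)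
  have key : ∀ {X Y : Sem J} (f : X ⟶ Y),
      (f ▷ b).hom = (e X).hom ≫ J.obj b ◁ f.hom ≫ (e Y).inv := fun {X Y} f =>
    (show ∀ (X Y : M) (f : J.obj X ⟶ J.obj Y), δ J X b ≫ f ▷ J.obj b ≫ μ J Y b =
      (e X).hom ≫ J.obj b ◁ f ≫ (e Y).inv from fun X Y f => by simp [e]) X Y f.hom
  have := isCop_transport h' (e A) (e B) (e C)
  change Nonempty (IsColimit (BinaryCofan.mk (inl ▷ b).hom (inr ▷ b).hom))
  rw [key inl, key inr]
  exact this

namespace Psh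

/-- The presheaf `A ↦ T (A ⊗ b)`. -/
def shift {K : Type u} [SmallCategory K] [MonoidalCategory K] (T : Psh K) (b : K) : Psh K where
  obj A := T.obj (A ⊗ b)
  map f := T.map (f ▷ b)
  map_id x := by simp
  map_comp f g x := by simp [T.map_comp]

/-- `A ↦ T (A ⊗ b)` is natural in `b`. -/
def shiftMap {K : Type u} [SmallCategory K] [MonoidalCategory K] (T : Psh K) {b b' : K}
    (q : b ⟶ b') : shift T b' ⟶ shift T b where
  app A := T.map (A ◁ q)
  nat {A B} f x := (T.map_comp (A ◁ q) (f ▷ b') x).symm.trans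
    ((congrArg (fun k => T.map k x) (whisker_exchange f q)).trans
      (T.map_comp (f ▷ b) (B ◁ q) x))

/-- A map out of a Day convolution, with the second variable fixed. -/
def fixR {P Z T : Psh (Sem J)} (φ : day P Z ⟶ T) {b : Sem J} (r : Z.obj b) : P ⟶ shift T b where
  app A x := φ.app (A ⊗ b) (dmk (𝟙 _) x r)
  nat {A B} f x := by
    refine Eq.trans (congrArg (φ.app _) ?_) (φ.nat (f ▷ b) (dmk (𝟙 _) x r))
    exact (dmk_glue_left f (𝟙 _) x r).trans (by simp)

theorem fixR_map {P Z T : Psh (Sem J)} (φ : day P Z ⟶ T) {b b' : Sem J} (q : b ⟶ b')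
    (r : Z.obj b') : fixR φ (Z.map q r) = fixR φ r ≫ shiftMap T q := by
  ext A x
  refine Eq.trans (congrArg (φ.app _) ?_) (φ.nat (A ◁ q) (dmk (𝟙 _) x r))
  exact (dmk_glue_right q (𝟙 _) x r).trans (by simp)

variable [∀ X : Q, PreservesColimitsOfShape (Discrete WalkingPair) (tensorLeft X)]

theorem shift_preserves {T : Psh (Sem J)} (hT : T.PreservesProducts) (b : Sem J) :
    (shift T b).PreservesProducts :=
  fun inl inr h => hT (inl ▷ b) (inr ▷ b) (h.whiskerRight b)

/-- The extension of a map `P ⊗ Z → T` to `L P ⊗ Z`, for `T` product-preserving. -/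
noncomputable def extR {P T : Psh (Sem J)} (Z : Psh (Sem J)) (hT : T.PreservesProducts)
    (φ : day P Z ⟶ T) : day (refl P) Z ⟶ T :=
  dayDesc ⟨fun {_ b} x r => (ext (shift_preserves hT b) (fixR φ r)).app _ x,
    fun {a a' b b'} p q x r => by
      have e : ext (shift_preserves hT b) (fixR φ (Z.map q r)) =
          ext (shift_preserves hT b') (fixR φ r) ≫ shiftMap T q :=
        refl_hom_ext (shift_preserves hT b) (fixR_map φ q r)
      rw [e, comp_app, Hom.nat]
      exact (T.map_comp (a ◁ q) (p ▷ b') _).symm.trans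
        (congrArg (fun k => T.map k _) (MonoidalCategory.tensorHom_def' p q).symm)⟩

theorem unit_extR {P T : Psh (Sem J)} (Z : Psh (Sem J)) (hT : T.PreservesProducts)
    (φ : day P Z ⟶ T) : dayMap (unit P) (𝟙 Z) ≫ extR Z hT φ = φ :=
  day_hom_ext fun {a b} x r => by
    rw [comp_app, dayMap_dmk]
    exact T.map_id _

theorem day_refl_hom_ext {P T : Psh (Sem J)} (Z : Psh (Sem J)) (hT : T.PreservesProducts)
    (φ ψ : day (refl P) Z ⟶ T)
    (h : dayMap (unit P) (𝟙 Z) ≫ φ = dayMap (unit P) (𝟙 Z) ≫ ψ) : φ = ψ := by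
  refine day_hom_ext fun {a b} x r => ?_
  have e : fixR φ r = fixR ψ r := by
    refine refl_hom_ext (shift_preserves hT b) ?_
    ext A y
    have := congrFun (congrFun (congrArg Hom.app h) (A ⊗ b)) (dmk (𝟙 _) y r)
    rw [comp_app, comp_app, dayMap_dmk] at this
    exact this
  exact congrFun (congrFun (congrArg Hom.app e) a) x

variable (J) in
/-- The reflection `L` onto the product-preserving presheaves. -/
noncomputable def reflMon : MonRefl (Psh (Sem J)) where
  Loc := PreservesProducts
  L := refl
  η := unit
  loc := refl_preserves
  loc_unit := rep_preserves _
  ext := ext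
  fac := unit_ext
  uniq hT _ _ := refl_hom_ext hT
  extR := extR
  facR := unit_extR
  uniqR := day_refl_hom_ext

end Psh
end MonReflection


/-! ### The symmetric monoidal structure of `C̃` -/

section Base2
variable {M Q : Type u} [SmallCategory M] [SmallCategory Q] {J : M ⥤ Q}

namespace BPsh

/-- A `V`-natural transformation, with the compatibility stated as an equation of
morphisms. -/
def Nat.ofEq {F G : BPsh J} (n0 : F.lev0 ⟶ G.lev0) (n1 : F.lev1 ⟶ G.lev1)
    (h : n1 ≫ G.strHom = F.strHom ≫ (Psh.res (toSem J)).map n0) : Nat F G where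
  n0 := n0
  n1 := n1
  comm A x := congrFun (congrFun (congrArg Psh.Hom.app h) A) x

theorem Nat.eq {F G : BPsh J} (n : Nat F G) :
    n.n1 ≫ G.strHom = F.strHom ≫ (Psh.res (toSem J)).map n.n0 :=
  Psh.hom_ext n.comm

/-- A `V`-natural transformation, as a map in the `V`-category `C̃`. -/
def Nat.toMap {F G : CTilde J} (n : Nat F.1 G.1) : 𝟙_ Biset.{u} ⟶ (F ⟶[Biset.{u}] G) :=
  ⟨fun _ => n.n0, fun _ => n, fun _ => rfl⟩

/-- An isomorphism of `C̃` from isomorphisms on both levels. -/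
def isoMk {F G : CTilde J} (e0 : F.1.lev0 ≅ G.1.lev0) (e1 : F.1.lev1 ≅ G.1.lev1)
    (h : e1.hom ≫ G.1.strHom = F.1.strHom ≫ (Psh.res (toSem J)).map e0.hom) :
    VIso Biset.{u} F G where
  hom := (Nat.ofEq e0.hom e1.hom h).toMap
  inv := (Nat.ofEq e0.inv e1.inv (by
    rw [Iso.inv_comp_eq, ← Category.assoc, h, Category.assoc, ← Functor.map_comp,
      Iso.hom_inv_id, CategoryTheory.Functor.map_id]; rfl)).toMap
  hom_inv := Biset.hom_ext (fun _ => e0.hom_inv_id) (fun _ =>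
    Nat.ext e0.hom_inv_id e1.hom_inv_id)
  inv_hom := Biset.hom_ext (fun _ => e0.inv_hom_id) (fun _ =>
    Nat.ext e0.inv_hom_id e1.inv_hom_id)

end BPsh
end Base2

section Main
variable {M Q : Type u} [SmallCategory M] [MonoidalCategory M] [SymmetricCategory M]
  [SmallCategory Q] [MonoidalCategory Q] [SymmetricCategory Q] (J : M ⥤ Q) [J.Braided]

open Functor.LaxMonoidal

/-- The presheaf `yI = C(-, I)` represented by the unit object. -/
def yUnit : BPsh J :=
  .ofLevels (Psh.rep (𝟙_ (Sem J))) (Psh.rep (𝟙_ M)) (Psh.resUnit (toSem J))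

variable {J} in
/-- The Day convolution of two `V`-presheaves: levelwise it is the Day convolution of presheaves
of sets over `Q` and over `M`, with the canonical comparison map. -/
def dayBPsh (F G : BPsh J) : BPsh J :=
  .ofLevels (Psh.day F.lev0 G.lev0) (Psh.day F.lev1 G.lev1)
    (Psh.dayMap F.strHom G.strHom ≫ Psh.resTensor (toSem J) F.lev0 G.lev0)

/-- The presheaf `C(-, I)`, as an object of `C̃`. -/
def unitTilde : CTilde J := ⟨yUnit J, Psh.rep_preserves _⟩

variable [∀ X : Q, PreservesColimitsOfShape (Discrete WalkingPair) (tensorLeft X)]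

variable {J}

/-- The tensor product `L̃ (i F ⊗ i G)` of `C̃`. -/
noncomputable def tenTilde (F G : CTilde J) : CTilde J :=
  (reflTilde J).obj (dayBPsh ((incl J).obj F) ((incl J).obj G))

theorem strHom_tenTilde (F G : CTilde J) : (tenTilde F G).1.strHom =
    (Psh.reflMon J).tensStr (Psh.res (toSem J)) F.1.strHom G.1.strHom := rfl

theorem strHom_unitTilde : (unitTilde J).1.strHom = ε (Psh.res (toSem J)) := rfl

theorem tenTilde_comm {F F' G G' : CTilde J} (n : BPsh.Nat F.1 F'.1) (m : BPsh.Nat G.1 G'.1) :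
    (n.n1 ⊗ₘ m.n1) ≫ (tenTilde F' G').1.strHom =
      (tenTilde F G).1.strHom ≫
        (Psh.res (toSem J)).map ((Psh.reflMon J).tensHom n.n0 m.n0) :=
  (Psh.reflMon J).tensStr_hom (Psh.res (toSem J)) n.eq m.eq

/-- `C̃` is a symmetric monoidal `V`-category. The coherence maps are induced by those of Day
convolution. -/
noncomputable instance : SymMonoidalVCat Biset.{u} (CTilde J) where
  I := unitTilde J
  ten := tenTilde
  tenHom F F' G G' := ⟨fun p => (Psh.reflMon J).tensHom p.1 p.2, fun p =>
    BPsh.Nat.ofEq ((Psh.reflMon J).tensHom p.1.n0 p.2.n0) (p.1.n1 ⊗ₘ p.2.n1)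
      (tenTilde_comm p.1 p.2), fun _ => rfl⟩
  tenHom_id F G := Biset.hom_ext (fun _ => (Psh.reflMon J).tensHom_id _ _)
    (fun _ => BPsh.Nat.ext ((Psh.reflMon J).tensHom_id _ _) (id_tensorHom_id _ _))
  tenHom_comp _ _ _ _ _ _ := Biset.hom_ext
    (fun p => (Psh.reflMon J).tensHom_comp p.1.1 p.2.1 p.1.2 p.2.2)
    (fun p => BPsh.Nat.ext ((Psh.reflMon J).tensHom_comp p.1.1.n0 p.2.1.n0 p.1.2.n0 p.2.2.n0)
      (tensorHom_comp_tensorHom _ _ _ _).symm)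
  assoc F G H := BPsh.isoMk ((Psh.reflMon J).assoc _ _ _) (α_ _ _ _)
    ((Psh.reflMon J).tensStr_assoc (Psh.res (toSem J)) F.1.strHom G.1.strHom H.1.strHom)
  lu F := BPsh.isoMk ((Psh.reflMon J).lu _ F.2) (λ_ _)
    ((Psh.reflMon J).tensStr_lu (Psh.res (toSem J)) F.2 F.1.strHom)
  ru F := BPsh.isoMk ((Psh.reflMon J).ru _ F.2) (ρ_ _)
    ((Psh.reflMon J).tensStr_ru (Psh.res (toSem J)) F.2 F.1.strHom)
  braid F G := BPsh.isoMk ((Psh.reflMon J).braid _ _) (β_ _ _)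
    ((Psh.reflMon J).tensStr_braid (Psh.res (toSem J)) F.1.strHom G.1.strHom)
  assoc_natural _ _ _ _ _ _ := Biset.hom_ext
    (fun p => (Psh.reflMon J).assoc_naturality p.1.1 p.1.2 p.2)
    (fun p => BPsh.Nat.ext ((Psh.reflMon J).assoc_naturality p.1.1.n0 p.1.2.n0 p.2.n0)
      (associator_naturality p.1.1.n1 p.1.2.n1 p.2.n1))
  lu_natural F G := Biset.hom_ext
    (fun f => (Psh.reflMon J).lu_naturality F.2 G.2 f)
    (fun f => BPsh.Nat.ext ((Psh.reflMon J).lu_naturality F.2 G.2 f.n0)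
      (leftUnitor_naturality f.n1))
  ru_natural F G := Biset.hom_ext
    (fun f => (Psh.reflMon J).ru_naturality F.2 G.2 f)
    (fun f => BPsh.Nat.ext ((Psh.reflMon J).ru_naturality F.2 G.2 f.n0)
      (rightUnitor_naturality f.n1))
  braid_natural _ _ _ _ := Biset.hom_ext
    (fun p => (Psh.reflMon J).braid_naturality p.1 p.2)
    (fun p => BPsh.Nat.ext ((Psh.reflMon J).braid_naturality p.1.n0 p.2.n0)
      (BraidedCategory.braiding_naturality p.1.n1 p.2.n1))
  pentagon W X Y Z := by
    have h0 := (Psh.reflMon J).pentagon W.1.lev0 X.1.lev0 Y.1.lev0 Z.1.lev0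
    have h1 := Psh.dayPentagon W.1.lev1 X.1.lev1 Y.1.lev1 Z.1.lev1
    exact Biset.hom_ext (fun _ => h0) (fun _ => BPsh.Nat.ext h0 h1)
  triangle X Y := by
    have h0 := (Psh.reflMon J).triangle X.1.lev0 Y.1.lev0 X.2 Y.2
    have h1 := MonoidalCategory.triangle X.1.lev1 Y.1.lev1
    exact Biset.hom_ext (fun _ => h0) (fun _ => BPsh.Nat.ext h0 h1)
  hexagon X Y Z := by
    have h0 := (Psh.reflMon J).hexagon X.1.lev0 Y.1.lev0 Z.1.lev0
    have h1 := Psh.dayHexagon X.1.lev1 Y.1.lev1 Z.1.lev1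
    exact Biset.hom_ext (fun _ => h0) (fun _ => BPsh.Nat.ext h0 h1)
  symmetry X Y := Biset.hom_ext (fun _ => (Psh.reflMon J).symmetry _ _)
    (fun _ => BPsh.Nat.ext ((Psh.reflMon J).symmetry _ _) (SymmetricCategory.symmetry _ _))

end Main

/-- Bisets with their cartesian product form a symmetric monoidal `V`-category. -/
instance : SymMonoidalVCat Biset.{u} Biset.{u} where
  I := 𝟙_ _
  ten X Y := X ⊗ Y
  tenHom _ _ _ _ := ⟨fun p => Prod.map p.1 p.2, fun p => p.1 ⊗ₘ p.2, fun _ => rfl⟩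
  tenHom_id _ _ := rfl
  tenHom_comp _ _ _ _ _ _ := rfl
  assoc X Y Z := ⟨⟨fun _ => (α_ X Y Z).hom.app0, fun _ => (α_ X Y Z).hom, fun _ => rfl⟩,
    ⟨fun _ => (α_ X Y Z).inv.app0, fun _ => (α_ X Y Z).inv, fun _ => rfl⟩, rfl, rfl⟩
  lu X := ⟨⟨fun _ => (λ_ X).hom.app0, fun _ => (λ_ X).hom, fun _ => rfl⟩,
    ⟨fun _ => (λ_ X).inv.app0, fun _ => (λ_ X).inv, fun _ => rfl⟩, rfl, rfl⟩
  ru X := ⟨⟨fun _ => (ρ_ X).hom.app0, fun _ => (ρ_ X).hom, fun _ => rfl⟩,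
    ⟨fun _ => (ρ_ X).inv.app0, fun _ => (ρ_ X).inv, fun _ => rfl⟩, rfl, rfl⟩
  braid X Y := ⟨⟨fun _ => (β_ X Y).hom.app0, fun _ => (β_ X Y).hom, fun _ => rfl⟩,
    ⟨fun _ => (β_ X Y).inv.app0, fun _ => (β_ X Y).inv, fun _ => rfl⟩, rfl, rfl⟩
  assoc_natural _ _ _ _ _ _ := rfl
  lu_natural _ _ := rfl
  ru_natural _ _ := rfl
  braid_natural _ _ _ _ := rfl
  pentagon _ _ _ _ := rfl
  triangle _ _ := rfl
  hexagon _ _ _ := rfl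
  symmetry _ _ := rfl

/-! ### The functors of the linear-non-linear adjunctions -/

section Functors
variable {M Q : Type u} [SmallCategory M] [SmallCategory Q] {J : M ⥤ Q}

/-- The presheaf `A ↦ X × P A`. -/
def Psh.prodLeft {K : Type u} [SmallCategory K] (X : Type u) (P : Psh K) : Psh K where
  obj A := X × P.obj A
  map f := Prod.map id (P.map f)
  map_id _ := Prod.ext rfl (P.map_id _)
  map_comp _ _ _ := Prod.ext rfl (P.map_comp _ _ _)

/-- The copower `X ⊙ F`, which sends `A` to the biset `X × F A`. -/
def copower (X : Biset.{u}) (F : BPsh J) : BPsh J :=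
  .ofLevels (F.lev0.prodLeft X.zero) (F.lev1.prodLeft X.one)
    ⟨fun A => Prod.map X.str (F.str A), fun f x => Prod.ext rfl (F.str_nat f x.2)⟩

/-- The copower, as a `V`-functor in its first variable. -/
def copowerFunctor (F : BPsh J) : EnrichedFunctor Biset.{u} Biset.{u} (BPsh J) where
  obj X := copower X F
  map _ _ := ⟨fun g => ⟨fun _ => Prod.map g id, fun _ _ => rfl⟩,
    fun g => ⟨⟨fun _ => Prod.map g.app0 id, fun _ _ => rfl⟩,
      ⟨fun _ => Prod.map g.app1 id, fun _ _ => rfl⟩,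
      fun _ x => Prod.ext (g.comm x.1) rfl⟩, fun _ => rfl⟩
  map_id _ := rfl
  map_comp _ _ _ := rfl

/-- The `V`-functor `C̄(F, -)`. -/
def homFunctor (F : BPsh J) : EnrichedFunctor Biset.{u} (BPsh J) Biset.{u} where
  obj G := F ⟶[Biset.{u}] G
  map G H := ⟨fun α β => β ≫ α, fun α => ⟨fun β => β ≫ α.n0, fun β =>
    ((eComp Biset.{u} F G H).app1 (β, α)), fun _ => rfl⟩, fun _ => rfl⟩
  map_id _ := rfl
  map_comp _ _ _ := rfl

end Functors

section Functors2
variable {M Q : Type u} [SmallCategory M] [MonoidalCategory M] [SymmetricCategory M]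
  [SmallCategory Q] [MonoidalCategory Q] [SymmetricCategory Q] (J : M ⥤ Q) [J.Braided]

/-- The `V`-functor `p(X) = X ⊙ I` from `V` to `C̄`. -/
def pBar : EnrichedFunctor Biset.{u} Biset.{u} (BPsh J) := copowerFunctor (yUnit J)

/-- The `V`-functor `♭(F) = C̄(I, F)` from `C̄` to `V`. -/
def flatBar : EnrichedFunctor Biset.{u} (BPsh J) Biset.{u} := homFunctor (yUnit J)

/-- The `V`-functor `p̃(X) = L̃(p(X))` from `V` to `C̃`. -/
noncomputable def pTilde : EnrichedFunctor Biset.{u} Biset.{u} (CTilde J) :=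
  EnrichedFunctor.comp Biset.{u} (pBar J) (reflTilde J)

/-- The `V`-functor `♭̃(F) = ♭(i F)` from `C̃` to `V`. -/
def flatTilde : EnrichedFunctor Biset.{u} (CTilde J) Biset.{u} :=
  EnrichedFunctor.comp Biset.{u} (incl J) (flatBar J)

end Functors2

end DynLift

/-! The adjunctions come from currying. A transformation from the copower of `F` by `X` to `G` is
the same as a family, indexed by `X`, of transformations from `F` to `G`. This gives `copowerAdj`,
and for `F = yUnit J` it is `p ⊣ ♭`. Since `p̃` and `♭̃` are composites of `V`-functors, composing
with `reflAdj` by `VAdjunction.comp` yields `p̃ ⊣ p̃♭`-style data directly: the hom-isomorphism of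
`p̃ ⊣ ♭̃` is by construction the composite of the two given ones.

Strong monoidality rests on two facts. The first is a coend computation, valid over any monoidal
category `K`: by the Yoneda lemma the coend of `K(D, a ⊗ b) × X × K(a, I) × Y × K(b, I)` is `X × Y ×
K(D, I ⊗ I)`, hence `X × Y × K(D, I)`. So the Day convolution of the copowers of the unit by `X` and
`Y` is its copower by `X × Y` (`dayUnitCopower`). Its coherence reduces to that of the
multiplication `I ⊗ I ≅ I`.

The second is that the reflection `L` is compatible with Day convolution: a map `P ⊗ Z ⟶ T` with `T`
product-preserving extends uniquely to `L P ⊗ Z`. This is where distributivity of the tensor product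
of `Q` over coproducts enters, since it makes `A ↦ T (A ⊗ b)` product-preserving. Extending in each
variable shows that `L (L X ⊗ L Y)` is `L (X ⊗ Y)`, so an isomorphism `X ⊗ Y ≅ T` induces one from
the tensor product of the reflections to `L T` (`MonRefl.mulIso`). Every coherence equation for the
induced maps has a local target and can be tested after restriction along the units `η`, where it
becomes the corresponding equation before reflection.

A map of `C̃` is determined by its lower level, over `Sem J`, and its upper level, over `M`
(`CTilde.map_ext`). On the upper level nothing is reflected and the equations are those of
`dayUnitCopower` over `M`; on the lower level they are those of `mulIso` applied to `dayUnitCopower`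
over `Sem J`. The two levels fit together because `toSem J` is monoidal (`Psh.resUnitCopower_mul`,
`MonRefl.mulIso_str`). -/

namespace DynLift

/-! ### Strong monoidality of a reflection compatible with the tensor product -/

namespace MonRefl
variable {𝒞 : Type v} [Category.{w} 𝒞] [MonoidalCategory 𝒞] [SymmetricCategory 𝒞]
  (R : MonRefl 𝒞)

/-- The action of the reflection on morphisms. -/
def map {X Y : 𝒞} (f : X ⟶ Y) : R.L X ⟶ R.L Y := R.ext (R.loc Y) (f ≫ R.η Y)

theorem η_map {X Y : 𝒞} (f : X ⟶ Y) : R.η X ≫ R.map f = f ≫ R.η Y := R.fac _ _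

/-- The map `R.η X ⊗ₘ R.η Y` is `X ◁ R.η Y` followed by `R.η X ▷ R.L Y`, and maps into a local
object are determined by restriction along each of these. -/
theorem uniqT {X Y T : 𝒞} (hT : R.Loc T) {f g : R.L X ⊗ R.L Y ⟶ T}
    (h : (R.η X ⊗ₘ R.η Y) ≫ f = (R.η X ⊗ₘ R.η Y) ≫ g) : f = g :=
  R.uniqR _ hT _ _ (R.uniqL _ hT _ _ (by
    simpa only [MonoidalCategory.tensorHom_def', Category.assoc] using h))

/-- The test used below for maps out of a tensor product of two reflections: it suffices to compare
them on `X ⊗ Y`. -/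
theorem tens_uniqT {X Y T : 𝒞} (hT : R.Loc T) {f g : R.tens (R.L X) (R.L Y) ⟶ T}
    (h : (R.η X ⊗ₘ R.η Y) ≫ R.ι _ _ ≫ f = (R.η X ⊗ₘ R.η Y) ≫ R.ι _ _ ≫ g) : f = g :=
  R.tens_uniq hT (R.uniqT hT h)

/-- The extension of a map `X ⊗ Y ⟶ T` to the tensor product of the reflections. -/
def extT {X Y T : 𝒞} (hT : R.Loc T) (f : X ⊗ Y ⟶ T) : R.tens (R.L X) (R.L Y) ⟶ T :=
  R.desc hT (R.extR _ hT (R.extL _ hT f))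

theorem η_extT {X Y T : 𝒞} (hT : R.Loc T) (f : X ⊗ Y ⟶ T) :
    (R.η X ⊗ₘ R.η Y) ≫ R.ι _ _ ≫ R.extT hT f = f := by
  simp [extT, MonoidalCategory.tensorHom_def']

theorem η_extT_assoc {X Y T T' : 𝒞} (hT : R.Loc T) (f : X ⊗ Y ⟶ T) (g : T ⟶ T') :
    (R.η X ⊗ₘ R.η Y) ≫ R.ι _ _ ≫ R.extT hT f ≫ g = f ≫ g := by
  have := congrArg (· ≫ g) (R.η_extT hT f)
  simpa using this

/-- The reflection of a tensor product is the tensor product of the reflections. -/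
@[simps]
def mulIso {X Y T : 𝒞} (m : X ⊗ Y ≅ T) : R.tens (R.L X) (R.L Y) ≅ R.L T where
  -- Both directions are forced by their restrictions along the units. The composites are compared
  -- on `X ⊗ Y` and on `T` respectively, where `m` cancels against its inverse.
  hom := R.extT (R.loc T) (m.hom ≫ R.η T)
  inv := R.ext (R.loc_tens _ _) (m.inv ≫ (R.η X ⊗ₘ R.η Y) ≫ R.ι _ _)
  hom_inv_id := R.tens_uniqT (R.loc_tens _ _) (by rw [η_extT_assoc]; simp)
  inv_hom_id := R.uniq (R.loc _) _ _ (by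
    rw [fac_assoc]; simp only [Category.assoc, η_extT]; simp)

/-- Restricted to `X ⊗ Y`, the two sides are the two sides of `e` followed by the unit at `T'`. -/
theorem mulIso_natural {X X' Y Y' T T' : 𝒞} (m : X ⊗ Y ≅ T) (m' : X' ⊗ Y' ≅ T')
    {f : X ⟶ X'} {g : Y ⟶ Y'} {h : T ⟶ T'} (e : (f ⊗ₘ g) ≫ m'.hom = m.hom ≫ h) :
    R.tensHom (R.map f) (R.map g) ≫ (R.mulIso m').hom = (R.mulIso m).hom ≫ R.map h := by
  refine R.tens_uniqT (R.loc _) ?_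
  rw [mulIso_hom, mulIso_hom, η_extT_assoc, ι_tensHom_assoc, tensorHom_comp_tensorHom_assoc,
    η_map, η_map, ← tensorHom_comp_tensorHom_assoc, η_extT, Category.assoc, η_map,
    reassoc_of% e]

/-- Reassociating tensors `R.L X` with the single object `Y ⊗ Z`, so that `uniqR` applies. -/
theorem uniqRR {X Y Z T : 𝒞} (hT : R.Loc T) {f g : (R.L X ⊗ Y) ⊗ Z ⟶ T}
    (h : R.η X ▷ Y ▷ Z ≫ f = R.η X ▷ Y ▷ Z ≫ g) : f = g := by
  have : (α_ _ _ _).inv ≫ f = (α_ _ _ _).inv ≫ g :=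
    R.uniqR _ hT _ _ (by simp only [whiskerRight_tensor, Category.assoc, Iso.hom_inv_id_assoc, h])
  simpa using this

/-- The braiding of the first two factors reduces this to `uniqRR`. -/
theorem uniqLR {X Y Z T : 𝒞} (hT : R.Loc T) {f g : (X ⊗ R.L Y) ⊗ Z ⟶ T}
    (h : (X ◁ R.η Y) ▷ Z ≫ f = (X ◁ R.η Y) ▷ Z ≫ g) : f = g := by
  have : (β_ _ _).hom ▷ Z ≫ f = (β_ _ _).hom ▷ Z ≫ g := by
    refine R.uniqRR hT ?_
    rw [← comp_whiskerRight_assoc, ← comp_whiskerRight_assoc,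
      BraidedCategory.braiding_naturality_left, comp_whiskerRight_assoc, comp_whiskerRight_assoc, h]
  exact (cancel_epi _).mp this

/-- The three-variable form of `uniqT`: the reflections are removed one at a time, from left to
right. -/
theorem uniqTT {X Y Z T : 𝒞} (hT : R.Loc T) {f g : (R.L X ⊗ R.L Y) ⊗ R.L Z ⟶ T}
    (h : ((R.η X ⊗ₘ R.η Y) ⊗ₘ R.η Z) ≫ f = ((R.η X ⊗ₘ R.η Y) ⊗ₘ R.η Z) ≫ g) : f = g :=
  R.uniqRR hT (R.uniqLR hT (R.uniqL _ hT _ _ (by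
    simpa only [MonoidalCategory.tensorHom_def', comp_whiskerRight, Category.assoc] using h)))

/-- Associativity of the multiplications before reflection, in the form `e`, passes to the
reflections: on `(X ⊗ Y) ⊗ Z` both sides become the sides of `e` followed by `R.η T`. The
isomorphisms are arbitrary, so that `a` may be the reassociation of a triple product of sets. -/
theorem mulIso_assoc {X Y Z XY YZ S T : 𝒞} (m₁ : X ⊗ Y ≅ XY) (m₂ : XY ⊗ Z ≅ S) (m₃ : Y ⊗ Z ≅ YZ)
    (m₄ : X ⊗ YZ ≅ T) {a : S ⟶ T}
    (e : m₁.hom ▷ Z ≫ m₂.hom ≫ a = (α_ X Y Z).hom ≫ X ◁ m₃.hom ≫ m₄.hom) :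
    R.tensHom (R.mulIso m₁).hom (𝟙 (R.L Z)) ≫ (R.mulIso m₂).hom ≫ R.map a =
      R.assocHom (R.L X) (R.L Y) (R.L Z) ≫ R.tensHom (𝟙 (R.L X)) (R.mulIso m₃).hom ≫
        (R.mulIso m₄).hom := by
  refine R.tens_uniqR (R.loc _) (R.uniqTT (R.loc _) ?_)
  -- `l` and `r` carry the three units past the inner multiplication, in the left and in the right
  -- bracketing. What remains is the outer multiplication restricted along two units, which `η_extT`
  -- evaluates.
  have l : ((R.η X ⊗ₘ R.η Y) ⊗ₘ R.η Z) ≫ R.ι _ _ ▷ R.L Z ≫ (R.mulIso m₁).hom ▷ R.L Z =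
      m₁.hom ▷ Z ≫ (R.η XY ⊗ₘ R.η Z) := by
    rw [← comp_whiskerRight, ← MonoidalCategory.tensorHom_id, tensorHom_comp_tensorHom,
      mulIso_hom, η_extT, Category.comp_id, ← MonoidalCategory.tensorHom_id,
      tensorHom_comp_tensorHom, Category.id_comp]
  have r : (R.η X ⊗ₘ R.η Y ⊗ₘ R.η Z) ≫ R.L X ◁ R.ι _ _ ≫ R.L X ◁ (R.mulIso m₃).hom =
      X ◁ m₃.hom ≫ (R.η X ⊗ₘ R.η YZ) := by
    rw [← whiskerLeft_comp, ← id_tensorHom, tensorHom_comp_tensorHom,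
      mulIso_hom, η_extT, Category.comp_id, ← id_tensorHom,
      tensorHom_comp_tensorHom, Category.id_comp]
  rw [ι_tensHom_assoc, ι_assocHom_assoc, ι_tensHom_assoc, MonoidalCategory.tensorHom_id,
    id_tensorHom, reassoc_of% l, associator_naturality_assoc, reassoc_of% r, mulIso_hom, mulIso_hom,
    η_extT, η_extT_assoc, Category.assoc, η_map, reassoc_of% e]

/-- The comparison of units, from an isomorphism between the unit and `E`. -/
@[simps]
def unitIso {E : 𝒞} (e : 𝟙_ 𝒞 ≅ E) : 𝟙_ 𝒞 ≅ R.L E where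
  hom := e.hom ≫ R.η E
  inv := R.ext R.loc_unit e.inv
  hom_inv_id := by simp
  inv_hom_id := R.uniq (R.loc _) _ _ (by rw [fac_assoc]; simp)

/-- The unit object is itself local, so only the reflection of `X` has to be tested. There both
sides become the left unitor of `X` followed by `R.η X`, by `h` and by naturality of the unitor. -/
theorem mulIso_left {E X T : 𝒞} (e : 𝟙_ 𝒞 ≅ E) (m : E ⊗ X ≅ T) {l : T ⟶ X}
    (h : e.hom ▷ X ≫ m.hom ≫ l = (λ_ X).hom) :
    R.tensHom (R.unitIso e).hom (𝟙 (R.L X)) ≫ (R.mulIso m).hom ≫ R.map l =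
      (R.lu (R.L X) (R.loc X)).hom := by
  refine R.tens_uniq (R.loc _) (R.uniqL _ (R.loc _) _ _ ?_)
  have k : 𝟙_ 𝒞 ◁ R.η X ≫ (R.unitIso e).hom ▷ R.L X = e.hom ▷ X ≫ (R.η E ⊗ₘ R.η X) := by
    rw [← id_tensorHom, ← MonoidalCategory.tensorHom_id, ← MonoidalCategory.tensorHom_id,
      tensorHom_comp_tensorHom, tensorHom_comp_tensorHom]
    simp
  rw [ι_tensHom_assoc, MonoidalCategory.tensorHom_id, reassoc_of% k, mulIso_hom, η_extT_assoc,
    Category.assoc, η_map, reassoc_of% h, ι_lu, leftUnitor_naturality]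

theorem mulIso_right {E X T : 𝒞} (e : 𝟙_ 𝒞 ≅ E) (m : X ⊗ E ≅ T) {r : T ⟶ X}
    (h : X ◁ e.hom ≫ m.hom ≫ r = (ρ_ X).hom) :
    R.tensHom (𝟙 (R.L X)) (R.unitIso e).hom ≫ (R.mulIso m).hom ≫ R.map r =
      (R.ru (R.L X) (R.loc X)).hom := by
  refine R.tens_uniq (R.loc _) (R.uniqR _ (R.loc _) _ _ ?_)
  have k : R.η X ▷ 𝟙_ 𝒞 ≫ R.L X ◁ (R.unitIso e).hom = X ◁ e.hom ≫ (R.η X ⊗ₘ R.η E) := by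
    rw [← id_tensorHom, ← MonoidalCategory.tensorHom_id, ← id_tensorHom,
      tensorHom_comp_tensorHom, tensorHom_comp_tensorHom]
    simp
  rw [ι_tensHom_assoc, id_tensorHom, reassoc_of% k, mulIso_hom, η_extT_assoc,
    Category.assoc, η_map, reassoc_of% h, ι_ru, rightUnitor_naturality]

/-- Naturality of the braiding exchanges the units of `X` and `Y`, so on `X ⊗ Y` the equation is `e`
followed by `R.η T`. -/
theorem mulIso_braid {X Y S T : 𝒞} (m : X ⊗ Y ≅ S) (m' : Y ⊗ X ≅ T) {b : S ⟶ T}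
    (e : m.hom ≫ b = (β_ X Y).hom ≫ m'.hom) :
    (R.mulIso m).hom ≫ R.map b = (R.braid (R.L X) (R.L Y)).hom ≫ (R.mulIso m').hom := by
  refine R.tens_uniqT (R.loc _) ?_
  rw [ι_braid_assoc, BraidedCategory.braiding_naturality_assoc, mulIso_hom, mulIso_hom,
    η_extT_assoc, η_extT, Category.assoc, η_map, reassoc_of% e]

/-! ### Compatibility of the multiplication with structure maps -/

section Lax
variable {𝒟 : Type u₁} [Category.{u₂} 𝒟] [MonoidalCategory 𝒟] (S : 𝒞 ⥤ 𝒟) [S.LaxMonoidal]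
open Functor.LaxMonoidal

/-- This glues the two levels. Here `S` plays the role of restriction to `M`, and `s`, `t`, `r` of
the structure maps before reflection. Naturality of `μ` moves the units inside `S`, where the
multiplication restricts to `m` followed by `R.η T`; then `h` applies. -/
theorem mulIso_str {X Y T : 𝒞} {X₁ Y₁ T₁ : 𝒟} {s : X₁ ⟶ S.obj X} {t : Y₁ ⟶ S.obj Y}
    {r : T₁ ⟶ S.obj T} (m : X ⊗ Y ≅ T) {m₁ : X₁ ⊗ Y₁ ⟶ T₁}
    (h : m₁ ≫ r = (s ⊗ₘ t) ≫ μ S X Y ≫ S.map m.hom) :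
    m₁ ≫ r ≫ S.map (R.η T) =
      ((s ≫ S.map (R.η X) ⊗ₘ t ≫ S.map (R.η Y)) ≫ μ S (R.L X) (R.L Y) ≫
        S.map (R.ι (R.L X) (R.L Y))) ≫ S.map (R.mulIso m).hom := by
  rw [← tensorHom_comp_tensorHom, Category.assoc, Category.assoc, Category.assoc,
    μ_natural_assoc, ← S.map_comp, ← S.map_comp, mulIso_hom, η_extT, S.map_comp, reassoc_of% h]

end Lax
end MonRefl

/-! ### Copowers of presheaves of sets -/

namespace Psh

section
variable {K : Type u} [SmallCategory K]

/-- The action of the copower on functions. -/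
def prodLeftMap {X Y : Type u} (g : X → Y) (P : Psh K) : P.prodLeft X ⟶ P.prodLeft Y :=
  ⟨fun _ => Prod.map g id, fun _ _ => rfl⟩

/-- The copower by a singleton. -/
def prodLeftUnit (P : Psh K) : P ≅ P.prodLeft PUnit.{u + 1} :=
  ⟨⟨fun _ i => (⟨⟩, i), fun _ _ => rfl⟩, ⟨fun _ p => p.2, fun _ _ => rfl⟩, rfl, rfl⟩

end

section
variable {K : Type u} [SmallCategory K] [MonoidalCategory K]

variable (K) in
/-- The copower of the unit presheaf. -/
abbrev unitCopower (X : Type u) : Psh K := (rep (𝟙_ K)).prodLeft X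

/-- The coend relation with the constant factors carried along: restriction in a copower moves only
the presheaf component. -/
theorem dmk_prodLeft {X Y : Type u} {P P' : Psh K} {D a b : K} (f : D ⟶ a ⊗ b) (x : X) (y : Y)
    {a' b' : K} (p : a ⟶ a') (q : b ⟶ b') (i : P.obj a') (j : P'.obj b') :
    (dmk f (x, P.map p i) (y, P'.map q j) : (day (P.prodLeft X) (P'.prodLeft Y)).obj D) =
      dmk (f ≫ (p ⊗ₘ q)) (x, i) (y, j) :=
  dmk_glue (F := P.prodLeft X) (G := P'.prodLeft Y) p q f (x, i) (y, j)

/-- The product of two elements of the unit presheaf. -/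
def unitMul {a b : K} (i : (rep (𝟙_ K)).obj a) (j : (rep (𝟙_ K)).obj b) :
    (rep (𝟙_ K)).obj (a ⊗ b) := ofHom ((toHom i ⊗ₘ toHom j) ≫ (λ_ (𝟙_ K)).hom)

/-- The Day convolution of copowers of the unit. -/
def dayUnitCopowerHom (X Y : Type u) :
    day (unitCopower K X) (unitCopower K Y) ⟶ unitCopower K (X × Y) :=
  dayDesc ⟨fun x y => ((x.1, y.1), unitMul x.2 y.2), fun p q x y => Prod.ext rfl (by
    change (p ≫ toHom x.2 ⊗ₘ q ≫ toHom y.2) ≫ (λ_ (𝟙_ K)).hom =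
      (p ⊗ₘ q) ≫ (toHom x.2 ⊗ₘ toHom y.2) ≫ (λ_ (𝟙_ K)).hom
    simp)⟩

/-- The Day convolution of copowers of the unit, as an isomorphism. -/
def dayUnitCopower (X Y : Type u) :
    unitCopower K X ⊗ unitCopower K Y ≅ unitCopower K (X × Y) where
  hom := dayUnitCopowerHom X Y
  -- A morphism `A ⟶ I` is read as `A ⟶ I ⊗ I`, and the generic element, the identity of `I`, is
  -- placed in both slots.
  inv := ⟨fun _ p => dmk (toHom p.2 ≫ (λ_ (𝟙_ K)).inv) (p.1.1, ofHom (𝟙 _)) (p.1.2, ofHom (𝟙 _)),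
    fun {A B} f p => by
      exact congrArg (fun k => dmk (F := unitCopower K X) (G := unitCopower K Y) k
        (p.1.1, ofHom (𝟙 _)) (p.1.2, ofHom (𝟙 _))) (Category.assoc f (toHom p.2) _)⟩
  hom_inv_id := day_hom_ext fun {a b} x y => by
    obtain ⟨x, i⟩ := x
    obtain ⟨y, j⟩ := y
    change (dmk ((𝟙 _ ≫ (toHom i ⊗ₘ toHom j) ≫ (λ_ (𝟙_ K)).hom) ≫ (λ_ (𝟙_ K)).inv)
      (x, ofHom (𝟙 _)) (y, ofHom (𝟙 _)) : (day (unitCopower K X) (unitCopower K Y)).obj _) =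
        dmk (𝟙 _) (x, i) (y, j)
    -- The Yoneda argument: `i` and `j` are restrictions of the identity of `I` along themselves, so
    -- the coend relation moves the generator to `a = b = I`.
    conv_rhs => rw [rep_eq i, rep_eq j, dmk_prodLeft]
    simp
  inv_hom_id := by
    ext A ⟨⟨x, y⟩, i⟩
    refine Prod.ext rfl ?_
    change (toHom i ≫ (λ_ (𝟙_ K)).inv) ≫ (𝟙 _ ⊗ₘ 𝟙 _) ≫ (λ_ (𝟙_ K)).hom = i
    simp
    rfl

theorem dayUnitCopower_natural {X X' Y Y' : Type u} (f : X → X') (g : Y → Y') :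
    (prodLeftMap f (rep (𝟙_ K)) ⊗ₘ prodLeftMap g (rep (𝟙_ K))) ≫ (dayUnitCopower X' Y').hom =
      (dayUnitCopower X Y).hom ≫ prodLeftMap (Prod.map f g) (rep (𝟙_ K)) := by
  refine day_hom_ext (F := unitCopower K X) (G := unitCopower K Y) fun x y => Prod.ext rfl ?_
  change (𝟙 _ ≫ 𝟙 _) ≫ (toHom x.2 ⊗ₘ toHom y.2) ≫ (λ_ (𝟙_ K)).hom =
    𝟙 _ ≫ (toHom x.2 ⊗ₘ toHom y.2) ≫ (λ_ (𝟙_ K)).hom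
  rw [Category.id_comp]

/-- On the set components both sides reassociate. On the unit component the equation says that `I ⊗
I ≅ I` is associative, which is the triangle identity together with the equality of the two unitors
at `I`. -/
theorem dayUnitCopower_assoc (X Y Z : Type u) :
    (dayUnitCopower (K := K) X Y).hom ▷ unitCopower K Z ≫ (dayUnitCopower (X × Y) Z).hom ≫
        prodLeftMap (fun p => (p.1.1, p.1.2, p.2)) (rep (𝟙_ K)) =
      (α_ _ _ _).hom ≫ unitCopower K X ◁ (dayUnitCopower Y Z).hom ≫
        (dayUnitCopower X (Y × Z)).hom := by
  refine day_hom_ext_left fun {a b c} x y z => Prod.ext rfl ?_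
  -- The unit components of both sides, evaluated at a generator.
  change (𝟙 _ ≫ 𝟙 _) ≫ ((𝟙 _ ≫ (toHom x.2 ⊗ₘ toHom y.2) ≫ (λ_ (𝟙_ K)).hom) ⊗ₘ toHom z.2) ≫
      (λ_ (𝟙_ K)).hom =
    ((𝟙 _ ≫ 𝟙 _ ▷ c ≫ (α_ a b c).hom) ≫ 𝟙 _) ≫
      (toHom x.2 ⊗ₘ (𝟙 _ ≫ (toHom y.2 ⊗ₘ toHom z.2) ≫ (λ_ (𝟙_ K)).hom)) ≫ (λ_ (𝟙_ K)).hom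
  have e1 : (((toHom x.2 ⊗ₘ toHom y.2) ≫ (λ_ (𝟙_ K)).hom) ⊗ₘ toHom z.2) =
      ((toHom x.2 ⊗ₘ toHom y.2) ⊗ₘ toHom z.2) ≫ (λ_ (𝟙_ K)).hom ▷ 𝟙_ K := by
    rw [← MonoidalCategory.tensorHom_id, tensorHom_comp_tensorHom, Category.comp_id]
  have e2 : (toHom x.2 ⊗ₘ ((toHom y.2 ⊗ₘ toHom z.2) ≫ (λ_ (𝟙_ K)).hom)) =
      (toHom x.2 ⊗ₘ toHom y.2 ⊗ₘ toHom z.2) ≫ 𝟙_ K ◁ (λ_ (𝟙_ K)).hom := by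
    rw [← id_tensorHom, tensorHom_comp_tensorHom, Category.comp_id]
  simp only [Category.id_comp, Category.comp_id, id_whiskerRight]
  rw [e1, e2, Category.assoc, Category.assoc, ← associator_naturality_assoc,
    MonoidalCategory.triangle_assoc, unitors_equal]

/-- After the singleton coordinate is dropped, what remains is naturality of the left unitor with
respect to the unit component of `x`. -/
theorem dayUnitCopower_left (X : Type u) :
    (prodLeftUnit (rep (𝟙_ K))).hom ▷ unitCopower K X ≫ (dayUnitCopower PUnit X).hom ≫
        prodLeftMap Prod.snd (rep (𝟙_ K)) = (λ_ (unitCopower K X)).hom := by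
  refine day_hom_ext (F := rep (𝟙_ K)) (G := unitCopower K X) fun {a b} i x => Prod.ext rfl ?_
  change (𝟙 _ ≫ 𝟙 _) ≫ (toHom i ⊗ₘ toHom x.2) ≫ (λ_ (𝟙_ K)).hom =
    𝟙 _ ≫ (toHom i ▷ b ≫ (λ_ b).hom) ≫ toHom x.2
  simp [MonoidalCategory.tensorHom_def]

/-- The multiplication of the unit is defined through the left unitor, so the equality of the two
unitors at `I` is needed here before naturality of the right one. -/
theorem dayUnitCopower_right (X : Type u) :
    unitCopower K X ◁ (prodLeftUnit (rep (𝟙_ K))).hom ≫ (dayUnitCopower X PUnit).hom ≫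
        prodLeftMap Prod.fst (rep (𝟙_ K)) = (ρ_ (unitCopower K X)).hom := by
  refine day_hom_ext (F := unitCopower K X) (G := rep (𝟙_ K)) fun {a b} x i => Prod.ext rfl ?_
  change (𝟙 _ ≫ 𝟙 _) ≫ (toHom x.2 ⊗ₘ toHom i) ≫ (λ_ (𝟙_ K)).hom =
    𝟙 _ ≫ (a ◁ toHom i ≫ (ρ_ a).hom) ≫ toHom x.2
  simp [MonoidalCategory.tensorHom_def', unitors_equal]

end

section
variable {K : Type u} [SmallCategory K] [MonoidalCategory K] [SymmetricCategory K]

/-- On the unit component this is commutativity of `I ⊗ I ≅ I`: the braiding of `I` with itself is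
absorbed by the unitor. -/
theorem dayUnitCopower_braid (X Y : Type u) :
    (dayUnitCopower (K := K) X Y).hom ≫ prodLeftMap Prod.swap (rep (𝟙_ K)) =
      (β_ _ _).hom ≫ (dayUnitCopower Y X).hom := by
  refine day_hom_ext (F := unitCopower K X) (G := unitCopower K Y) fun {a b} x y =>
    Prod.ext rfl ?_
  change 𝟙 _ ≫ (toHom x.2 ⊗ₘ toHom y.2) ≫ (λ_ (𝟙_ K)).hom =
    (𝟙 _ ≫ (β_ a b).hom) ≫ (toHom y.2 ⊗ₘ toHom x.2) ≫ (λ_ (𝟙_ K)).hom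
  rw [Category.id_comp, Category.id_comp, ← BraidedCategory.braiding_naturality_assoc,
    braiding_leftUnitor, unitors_equal]

end

section
open Functor.Monoidal Functor.LaxMonoidal Functor.OplaxMonoidal
variable {K K' : Type u} [SmallCategory K] [MonoidalCategory K] [SmallCategory K']
  [MonoidalCategory K'] (P : K ⥤ K') [P.Monoidal]

/-- The comparison of the copowers of the units. -/
def resUnitCopower {X Y : Type u} (s : X → Y) :
    unitCopower K X ⟶ (res P).obj (unitCopower K' Y) :=
  ⟨fun A => Prod.map s ((resUnit P).app A), fun f x => Prod.ext rfl ((resUnit P).nat f x.2)⟩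

/-- On the set components both sides are `s` and `t`. On the unit component it is the compatibility
of `P` with the unitors. For `P = toSem J` this is the hypothesis `h` of `MonRefl.mulIso_str`. -/
theorem resUnitCopower_mul {X X' Y Y' : Type u} (s : X → X') (t : Y → Y') :
    (dayUnitCopower X Y).hom ≫ resUnitCopower P (Prod.map s t) =
      (resUnitCopower P s ⊗ₘ resUnitCopower P t) ≫
        μ (res P) (unitCopower K' X') (unitCopower K' Y') ≫
          (res P).map (dayUnitCopower X' Y').hom := by
  refine day_hom_ext (F := unitCopower K X) (G := unitCopower K Y) fun {a b} x y =>
    Prod.ext rfl ?_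
  change P.map (𝟙 _ ≫ (toHom x.2 ⊗ₘ toHom y.2) ≫ (λ_ (𝟙_ K)).hom) ≫ η P =
    (P.map (𝟙 _ ≫ 𝟙 _) ≫ δ P a b) ≫ (P.map (toHom x.2) ≫ η P ⊗ₘ P.map (toHom y.2) ≫ η P) ≫
      (λ_ (𝟙_ K')).hom
  rw [← tensorHom_comp_tensorHom]
  simp [MonoidalCategory.tensorHom_def]

end
end Psh

/-! ### The adjunctions -/

/-- The composite of two adjunctions enriched over bisets. -/
def VAdjunction.comp {A B C : Type*} [EnrichedCategory Biset.{u} A] [EnrichedCategory Biset.{u} B]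
    [EnrichedCategory Biset.{u} C] {F : EnrichedFunctor Biset.{u} A B}
    {G : EnrichedFunctor Biset.{u} B A} {F' : EnrichedFunctor Biset.{u} B C}
    {G' : EnrichedFunctor Biset.{u} C B} (adj : VAdjunction Biset.{u} F G)
    (adj' : VAdjunction Biset.{u} F' G') :
    VAdjunction Biset.{u} (F.comp Biset.{u} F') (G'.comp Biset.{u} G) where
  homIso X Y := adj'.homIso (F.obj X) Y ≪≫ adj.homIso X (G'.obj Y)
  natural_right X Y Y' := by
    have h := adj.natural_right X (G'.obj Y) (G'.obj Y')
    have h' := adj'.natural_right (F.obj X) Y Y'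
    change eComp Biset.{u} (F'.obj (F.obj X)) Y Y' ≫ (adj'.homIso (F.obj X) Y').hom ≫
        (adj.homIso X (G'.obj Y')).hom =
      ((adj'.homIso (F.obj X) Y).hom ≫ (adj.homIso X (G'.obj Y)).hom ⊗ₘ
        G'.map Y Y' ≫ G.map (G'.obj Y) (G'.obj Y')) ≫ eComp Biset.{u} X _ _
    rw [reassoc_of% h', h, tensorHom_comp_tensorHom_assoc]
  natural_left X' X Y := by
    have h := adj.natural_left X' X (G'.obj Y)
    have h' := adj'.natural_left (F.obj X') (F.obj X) Y
    change (F.map X' X ≫ F'.map (F.obj X') (F.obj X)) ▷ _ ≫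
        eComp Biset.{u} (F'.obj (F.obj X')) (F'.obj (F.obj X)) Y ≫
          (adj'.homIso (F.obj X') Y).hom ≫ (adj.homIso X' (G'.obj Y)).hom =
      _ ◁ ((adj'.homIso (F.obj X) Y).hom ≫ (adj.homIso X (G'.obj Y)).hom) ≫ eComp Biset.{u} X' X _
    -- After both naturality squares, the two sides differ only in the order in which the two
    -- factors of the tensor product are acted on.
    rw [comp_whiskerRight_assoc, reassoc_of% h', whiskerLeft_comp_assoc, ← h,
      whisker_exchange_assoc]

section
variable {M Q : Type u} [SmallCategory M] [SmallCategory Q] {J : M ⥤ Q}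

/-- The adjunction between the copower with `F` and the functor represented by `F`. -/
def copowerAdj (F : BPsh J) : VAdjunction Biset.{u} (copowerFunctor F) (homFunctor F) where
  homIso X G := Biset.mkIso
    ⟨fun α x => ⟨fun A i => α.app A (x, i), fun f i => α.nat f (x, i)⟩,
      fun α => ⟨fun x => ⟨fun A i => α.n0.app A (x, i), fun f i => α.n0.nat f (x, i)⟩,
        -- At an upper element `x` the lower component must be the one at `X.str x`, because the
        -- result has to be a morphism of bisets.
        fun x => ⟨⟨fun A i => α.n0.app A (X.str x, i), fun f i => α.n0.nat f (X.str x, i)⟩,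
          ⟨fun A i => α.n1.app A (x, i), fun f i => α.n1.nat f (x, i)⟩,
          fun A i => α.comm A (x, i)⟩, fun _ => rfl⟩, fun _ => rfl⟩
    ⟨fun α => ⟨fun A p => (α p.1).app A p.2, fun f p => (α p.1).nat f p.2⟩,
      fun α => ⟨⟨fun A p => (α.app0 p.1).app A p.2, fun f p => (α.app0 p.1).nat f p.2⟩,
        ⟨fun A p => (α.app1 p.1).n1.app A p.2, fun f p => (α.app1 p.1).n1.nat f p.2⟩,
        fun A p => ((α.app1 p.1).comm A p.2).trans
          (congrArg (fun n : F.lev0 ⟶ G.lev0 => n.app A (F.str A p.2)) (α.comm p.1))⟩,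
      fun _ => rfl⟩
    rfl
    -- Uncurrying and currying again replaces the lower part of `α.app1 x` by `α.app0 (X.str x)`;
    -- the commutative square of `α` identifies them.
    (Biset.hom_ext (fun _ => rfl) fun α => Biset.hom_ext (fun _ => rfl) fun x =>
      BPsh.Nat.ext (α.comm x).symm rfl)
  natural_right _ _ _ := rfl
  -- The lower parts at an upper element `x` are formed by applying the map of bisets before or
  -- after the structure map; they agree by its commutative square.
  natural_left _ _ _ := Biset.hom_ext (fun _ => rfl) fun p => Biset.hom_ext (fun _ => rfl)
    fun x => BPsh.Nat.ext (Psh.hom_ext fun A i =>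
      congrArg (fun y => p.2.n0.app A (y, i)) (p.1.comm x).symm) rfl

end

/-! ### The strong monoidal structure -/

section
variable {M Q : Type u} [SmallCategory M] [MonoidalCategory M] [SymmetricCategory M]
  [SmallCategory Q] [MonoidalCategory Q] [SymmetricCategory Q] (J : M ⥤ Q) [J.Braided]
  [∀ X : Q, PreservesColimitsOfShape (Discrete WalkingPair) (tensorLeft X)]

/-- The structure map before reflection followed by the unit, the shape to which
`MonRefl.mulIso_str` applies. -/
theorem strHom_pTilde (X : Biset.{u}) : ((pTilde J).obj X).1.strHom =
    Psh.resUnitCopower (toSem J) X.str ≫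
      (Psh.res (toSem J)).map (Psh.unit (Psh.unitCopower (Sem J) X.zero)) := rfl

/-- The condition for the isomorphisms on the two levels to form a single isomorphism of `C̃`. -/
theorem dayUnitCopower_strHom (X Y : Biset.{u}) :
    (Psh.dayUnitCopower X.one Y.one).hom ≫ ((pTilde J).obj (X ⊗ Y)).1.strHom =
      (tenTilde ((pTilde J).obj X) ((pTilde J).obj Y)).1.strHom ≫
        (Psh.res (toSem J)).map
          ((Psh.reflMon J).mulIso (Psh.dayUnitCopower X.zero Y.zero)).hom := by
  rw [strHom_tenTilde, strHom_pTilde, strHom_pTilde, strHom_pTilde]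
  exact (Psh.reflMon J).mulIso_str (Psh.res (toSem J)) (Psh.dayUnitCopower X.zero Y.zero)
    (Psh.resUnitCopower_mul (toSem J) X.str Y.str)

/-- The functor `p̃` preserves tensor products. -/
noncomputable def pTildeMul (X Y : Biset.{u}) :
    VIso Biset.{u} (tenTilde ((pTilde J).obj X) ((pTilde J).obj Y)) ((pTilde J).obj (X ⊗ Y)) :=
  BPsh.isoMk ((Psh.reflMon J).mulIso (Psh.dayUnitCopower X.zero Y.zero))
    (Psh.dayUnitCopower X.one Y.one)
    (dayUnitCopower_strHom J X Y)

theorem prodLeftUnit_strHom :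
    (Psh.prodLeftUnit (Psh.rep (𝟙_ M))).hom ≫ ((pTilde J).obj (𝟙_ Biset.{u})).1.strHom =
      (unitTilde J).1.strHom ≫ (Psh.res (toSem J)).map
        ((Psh.reflMon J).unitIso (Psh.prodLeftUnit (Psh.rep (𝟙_ (Sem J))))).hom := by
  rw [strHom_pTilde]
  rfl

/-- The functor `p̃` preserves the unit. -/
noncomputable def pTildeUnit :
    VIso Biset.{u} (unitTilde J) ((pTilde J).obj (𝟙_ Biset.{u})) :=
  BPsh.isoMk ((Psh.reflMon J).unitIso (Psh.prodLeftUnit (Psh.rep (𝟙_ (Sem J)))))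
    (Psh.prodLeftUnit (Psh.rep (𝟙_ M))) (prodLeftUnit_strHom J)

end

section
variable {M Q : Type u} [SmallCategory M] [MonoidalCategory M] [SymmetricCategory M]
  [SmallCategory Q] [MonoidalCategory Q] [SymmetricCategory Q] {J : M ⥤ Q} [J.Braided]
  [∀ X : Q, PreservesColimitsOfShape (Discrete WalkingPair) (tensorLeft X)]

/-! ### The two levels of a map in `C̃` -/

namespace CTilde

/-- The lower level of a map in `C̃`. -/
def low {F G : CTilde J} (f : 𝟙_ Biset.{u} ⟶ (F ⟶[Biset.{u}] G)) : F.1.lev0 ⟶ G.1.lev0 :=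
  f.app0 ⟨⟩

/-- The upper level of a map in `C̃`. -/
def up {F G : CTilde J} (f : 𝟙_ Biset.{u} ⟶ (F ⟶[Biset.{u}] G)) : F.1.lev1 ⟶ G.1.lev1 :=
  BPsh.Nat.n1 (F := F.1) (G := G.1) (f.app1 ⟨⟩)

/-- The upper component also contains a transformation over `Sem J`, but the commutative square
forces it to be the lower level. Hence only the part over `M` has to be compared in addition. -/
theorem map_ext {F G : CTilde J} {f g : 𝟙_ Biset.{u} ⟶ (F ⟶[Biset.{u}] G)}
    (h0 : low f = low g) (h1 : up f = up g) : f = g :=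
  Biset.hom_ext (fun _ => h0) fun _ =>
    BPsh.Nat.ext ((f.comm ⟨⟩).trans (h0.trans (g.comm ⟨⟩).symm)) h1

variable {F G H F' G' : CTilde J}

/-- Here and up to `up_braid`, the levels respect all the structure by definition: `low` turns it
into that of `Psh.reflMon J`, and `up` into Day convolution over `M`. -/
theorem low_ucomp (f : 𝟙_ Biset.{u} ⟶ (F ⟶[Biset.{u}] G)) (g : 𝟙_ Biset.{u} ⟶ (G ⟶[Biset.{u}] H)) :
    low (ucomp Biset.{u} f g) = low f ≫ low g := rfl

theorem up_ucomp (f : 𝟙_ Biset.{u} ⟶ (F ⟶[Biset.{u}] G)) (g : 𝟙_ Biset.{u} ⟶ (G ⟶[Biset.{u}] H)) :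
    up (ucomp Biset.{u} f g) = up f ≫ up g := rfl

theorem low_utensor (f : 𝟙_ Biset.{u} ⟶ (F ⟶[Biset.{u}] F'))
    (g : 𝟙_ Biset.{u} ⟶ (G ⟶[Biset.{u}] G')) :
    low (utensor Biset.{u} f g) = (Psh.reflMon J).tensHom (low f) (low g) := rfl

theorem up_utensor (f : 𝟙_ Biset.{u} ⟶ (F ⟶[Biset.{u}] F'))
    (g : 𝟙_ Biset.{u} ⟶ (G ⟶[Biset.{u}] G')) :
    up (utensor Biset.{u} f g) = (up f ⊗ₘ up g) := rfl

theorem low_eId (F : CTilde J) : low (eId Biset.{u} F) = 𝟙 _ := rfl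

theorem up_eId (F : CTilde J) : up (eId Biset.{u} F) = 𝟙 _ := rfl

theorem low_assoc (F G H : CTilde J) :
    low (SymMonoidalVCat.assoc (V := Biset.{u}) F G H).hom =
      (Psh.reflMon J).assocHom F.1.lev0 G.1.lev0 H.1.lev0 := rfl

theorem up_assoc (F G H : CTilde J) :
    up (SymMonoidalVCat.assoc (V := Biset.{u}) F G H).hom =
      (α_ F.1.lev1 G.1.lev1 H.1.lev1).hom := rfl

theorem low_lu (F : CTilde J) : low (SymMonoidalVCat.lu (V := Biset.{u}) F).hom =
    ((Psh.reflMon J).lu F.1.lev0 F.2).hom := rfl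

theorem up_lu (F : CTilde J) : up (SymMonoidalVCat.lu (V := Biset.{u}) F).hom =
    (λ_ F.1.lev1).hom := rfl

theorem low_ru (F : CTilde J) : low (SymMonoidalVCat.ru (V := Biset.{u}) F).hom =
    ((Psh.reflMon J).ru F.1.lev0 F.2).hom := rfl

theorem up_ru (F : CTilde J) : up (SymMonoidalVCat.ru (V := Biset.{u}) F).hom =
    (ρ_ F.1.lev1).hom := rfl

theorem low_braid (F G : CTilde J) : low (SymMonoidalVCat.braid (V := Biset.{u}) F G).hom =
    ((Psh.reflMon J).braid F.1.lev0 G.1.lev0).hom := rfl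

theorem up_braid (F G : CTilde J) : up (SymMonoidalVCat.braid (V := Biset.{u}) F G).hom =
    (β_ F.1.lev1 G.1.lev1).hom := rfl

end CTilde

/-! ### Coherence of the monoidal structure of `p̃` -/

section
variable (J)
open CTilde

theorem low_pTildeMul (X Y : Biset.{u}) : low (pTildeMul J X Y).hom =
    ((Psh.reflMon J).mulIso (Psh.dayUnitCopower X.zero Y.zero)).hom := rfl

theorem up_pTildeMul (X Y : Biset.{u}) : up (pTildeMul J X Y).hom =
    (Psh.dayUnitCopower X.one Y.one).hom := rfl

theorem low_pTildeUnit : low (pTildeUnit J).hom =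
    ((Psh.reflMon J).unitIso (Psh.prodLeftUnit (Psh.rep (𝟙_ (Sem J))))).hom := rfl

theorem up_pTildeUnit : up (pTildeUnit J).hom = (Psh.prodLeftUnit (Psh.rep (𝟙_ M))).hom := rfl

theorem low_pTilde_map {X Y : Biset.{u}} (f : 𝟙_ Biset.{u} ⟶ (X ⟶[Biset.{u}] Y)) :
    low (f ≫ (pTilde J).map X Y) =
      (Psh.reflMon J).map (Psh.prodLeftMap (f.app0 ⟨⟩) (Psh.rep (𝟙_ (Sem J)))) := rfl

theorem up_pTilde_map {X Y : Biset.{u}} (f : 𝟙_ Biset.{u} ⟶ (X ⟶[Biset.{u}] Y)) :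
    up (f ≫ (pTilde J).map X Y) =
      Psh.prodLeftMap (Biset.Hom.app1 (X := X) (Y := Y) (f.app1 ⟨⟩)) (Psh.rep (𝟙_ M)) := rfl

open SymMonoidalVCat

/-- Enriched naturality concerns all elements of the hom-bisets: pairs of functions on the lower
level, pairs of morphisms of bisets on the upper one. A pair of the second kind requires naturality
over `Sem J` for its lower functions and over `M` for its upper functions. -/
theorem pTildeMul_natural (X X' Y Y' : Biset.{u}) :
    ((pTilde J).map X X' ⊗ₘ (pTilde J).map Y Y') ≫ tenHom _ _ _ _ ≫
        ePost Biset.{u} _ (pTildeMul J X' Y').hom =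
      tenHom X X' Y Y' ≫ (pTilde J).map (ten Biset.{u} X Y) (ten Biset.{u} X' Y') ≫
        ePre Biset.{u} (pTildeMul J X Y).hom _ := by
  have h0 (f : X.zero → X'.zero) (g : Y.zero → Y'.zero) :=
    (Psh.reflMon J).mulIso_natural _ _ (Psh.dayUnitCopower_natural (K := Sem J) f g)
  have h1 (f : X.one → X'.one) (g : Y.one → Y'.one) :=
    Psh.dayUnitCopower_natural (K := M) f g
  exact Biset.hom_ext (fun p => h0 p.1 p.2)
    (fun p => BPsh.Nat.ext (h0 p.1.app0 p.2.app0) (h1 p.1.app1 p.2.app1))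

/-- This is `MonRefl.mulIso_assoc` for the unit copowers over `Sem J`, with the reassociation of
triples as the map `a`. -/
theorem low_pTildeMul_assoc (X Y Z : Biset.{u}) :
    ((Psh.reflMon J).tensHom (low (pTildeMul J X Y).hom) (𝟙 ((pTilde J).obj Z).1.lev0) ≫
        low (pTildeMul J (X ⊗ Y) Z).hom) ≫ low ((assoc X Y Z).hom ≫ (pTilde J).map _ _) =
      ((Psh.reflMon J).assocHom ((pTilde J).obj X).1.lev0 ((pTilde J).obj Y).1.lev0
        ((pTilde J).obj Z).1.lev0 ≫
          (Psh.reflMon J).tensHom (𝟙 ((pTilde J).obj X).1.lev0) (low (pTildeMul J Y Z).hom)) ≫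
        low (pTildeMul J X (Y ⊗ Z)).hom := by
  have h := (Psh.reflMon J).mulIso_assoc (Psh.dayUnitCopower X.zero Y.zero)
    (Psh.dayUnitCopower (X.zero × Y.zero) Z.zero) (Psh.dayUnitCopower Y.zero Z.zero)
    (Psh.dayUnitCopower X.zero (Y.zero × Z.zero))
    (Psh.dayUnitCopower_assoc (K := Sem J) X.zero Y.zero Z.zero)
  rw [← Category.assoc, ← Category.assoc ((Psh.reflMon J).assocHom _ _ _)] at h
  -- The lower levels of the maps of `C̃` are by definition the maps that occur in `h`.
  have e₁ : (Psh.reflMon J).tensHom (low (pTildeMul J X Y).hom) (𝟙 ((pTilde J).obj Z).1.lev0) =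
    (Psh.reflMon J).tensHom ((Psh.reflMon J).mulIso (Psh.dayUnitCopower X.zero Y.zero)).hom
      (𝟙 ((Psh.reflMon J).L (Psh.unitCopower (Sem J) Z.zero))) := rfl
  have e₂ : low (pTildeMul J (X ⊗ Y) Z).hom =
    ((Psh.reflMon J).mulIso (Psh.dayUnitCopower (X.zero × Y.zero) Z.zero)).hom := rfl
  have e₃ : low ((assoc X Y Z).hom ≫ (pTilde J).map _ _) =
    (Psh.reflMon J).map (Psh.prodLeftMap
      (fun p : (X.zero × Y.zero) × Z.zero => (p.1.1, p.1.2, p.2)) (Psh.rep (𝟙_ (Sem J)))) := rfl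
  rw [e₁, e₂, e₃]
  exact h

/-- The lower level is the reflected equation; the upper level is `Psh.dayUnitCopower_assoc` over
`M` itself, since the reflection leaves that level unchanged. The unit and symmetry laws below split
in the same way. -/
theorem pTildeMul_assoc (X Y Z : Biset.{u}) :
    ucomp Biset.{u} (ucomp Biset.{u} (utensor Biset.{u} (pTildeMul J X Y).hom
        (eId Biset.{u} ((pTilde J).obj Z))) (pTildeMul J (ten Biset.{u} X Y) Z).hom)
        ((assoc X Y Z).hom ≫ (pTilde J).map _ _) =
      ucomp Biset.{u} (ucomp Biset.{u}
        (assoc ((pTilde J).obj X) ((pTilde J).obj Y) ((pTilde J).obj Z)).hom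
        (utensor Biset.{u} (eId Biset.{u} ((pTilde J).obj X)) (pTildeMul J Y Z).hom))
          (pTildeMul J X (ten Biset.{u} Y Z)).hom := by
  refine map_ext ?_ ?_
  · rw [low_ucomp, low_ucomp, low_ucomp, low_ucomp, low_utensor, low_utensor, low_eId, low_eId,
      low_assoc]
    exact low_pTildeMul_assoc J X Y Z
  · rw [up_ucomp, up_ucomp, up_ucomp, up_ucomp, up_utensor, up_utensor, up_eId, up_eId,
      up_assoc, up_pTilde_map,
      up_pTildeMul, up_pTildeMul, up_pTildeMul, up_pTildeMul]
    exact (Category.assoc _ _ _).trans ((Psh.dayUnitCopower_assoc (K := M) X.one Y.one Z.one).trans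
      (Category.assoc _ _ _).symm)

theorem pTildeMul_left (X : Biset.{u}) : (lu ((pTilde J).obj X)).hom =
    ucomp Biset.{u} (ucomp Biset.{u} (utensor Biset.{u} (pTildeUnit J).hom
      (eId Biset.{u} ((pTilde J).obj X))) (pTildeMul J (I Biset.{u}) X).hom)
        ((lu X).hom ≫ (pTilde J).map _ _) := by
  refine map_ext ?_ ?_
  · rw [low_ucomp, low_ucomp, low_utensor, low_eId, low_lu, low_pTilde_map,
      low_pTildeMul, low_pTildeUnit]
    exact ((Category.assoc _ _ _).trans ((Psh.reflMon J).mulIso_left _ _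
      (Psh.dayUnitCopower_left (K := Sem J) X.zero))).symm
  · rw [up_ucomp, up_ucomp, up_utensor, up_eId, up_lu, up_pTilde_map,
      up_pTildeMul, up_pTildeUnit]
    exact ((Category.assoc _ _ _).trans (Psh.dayUnitCopower_left (K := M) X.one)).symm

theorem pTildeMul_right (X : Biset.{u}) : (ru ((pTilde J).obj X)).hom =
    ucomp Biset.{u} (ucomp Biset.{u} (utensor Biset.{u} (eId Biset.{u} ((pTilde J).obj X))
      (pTildeUnit J).hom) (pTildeMul J X (I Biset.{u})).hom)
        ((ru X).hom ≫ (pTilde J).map _ _) := by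
  refine map_ext ?_ ?_
  · rw [low_ucomp, low_ucomp, low_utensor, low_eId, low_ru, low_pTilde_map,
      low_pTildeMul, low_pTildeUnit]
    exact ((Category.assoc _ _ _).trans ((Psh.reflMon J).mulIso_right _ _
      (Psh.dayUnitCopower_right (K := Sem J) X.zero))).symm
  · rw [up_ucomp, up_ucomp, up_utensor, up_eId, up_ru, up_pTilde_map,
      up_pTildeMul, up_pTildeUnit]
    exact ((Category.assoc _ _ _).trans (Psh.dayUnitCopower_right (K := M) X.one)).symm

theorem pTildeMul_braid (X Y : Biset.{u}) :
    ucomp Biset.{u} (pTildeMul J X Y).hom ((braid X Y).hom ≫ (pTilde J).map _ _) =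
      ucomp Biset.{u} (braid ((pTilde J).obj X) ((pTilde J).obj Y)).hom (pTildeMul J Y X).hom := by
  refine map_ext ?_ ?_
  · rw [low_ucomp, low_ucomp, low_braid, low_pTilde_map, low_pTildeMul, low_pTildeMul]
    exact (Psh.reflMon J).mulIso_braid _ _
      (Psh.dayUnitCopower_braid (K := Sem J) X.zero Y.zero)
  · rw [up_ucomp, up_ucomp, up_braid, up_pTilde_map, up_pTildeMul, up_pTildeMul]
    exact Psh.dayUnitCopower_braid (K := M) X.one Y.one

/-- The functor `p̃` is strong symmetric monoidal. -/
noncomputable def pTildeStrongMonoidal : StrongMonoidal Biset.{u} (pTilde J) where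
  ε := pTildeUnit J
  μ := pTildeMul J
  μ_natural := pTildeMul_natural J
  associativity := pTildeMul_assoc J
  left_unitality := pTildeMul_left J
  right_unitality := pTildeMul_right J
  braided := pTildeMul_braid J

end
end
end DynLift

theorem mainTheorem7 {M Q : Type u} [SmallCategory M] [MonoidalCategory M] [SymmetricCategory M]
    [SmallCategory Q] [MonoidalCategory Q] [SymmetricCategory Q]
    (J : M ⥤ Q) [J.Braided] (hJ : Function.Bijective J.obj)
    [∀ X : Q, PreservesColimitsOfShape (Discrete WalkingPair) (tensorLeft X)] :
    ∃ (adj : DynLift.VAdjunction DynLift.Biset.{u} (DynLift.pBar J) (DynLift.flatBar J))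
      (adjTilde : DynLift.VAdjunction DynLift.Biset.{u} (DynLift.pTilde J) (DynLift.flatTilde J)),
      (∀ (X : DynLift.Biset.{u}) (F : DynLift.CTilde J), adjTilde.homIso X F =
        (DynLift.reflAdj J).homIso ((DynLift.pBar J).obj X) F ≪≫
          adj.homIso X ((DynLift.incl J).obj F)) ∧
      Nonempty (DynLift.StrongMonoidal DynLift.Biset.{u} (DynLift.pTilde J)) :=
  -- The first adjunction is taken at `yUnit J`. The formula for the second holds by definition,
  -- since `VAdjunction.comp` composes the hom-isomorphisms in exactly this order.
  ⟨DynLift.copowerAdj _, (DynLift.copowerAdj _).comp (DynLift.reflAdj J), fun _ _ => rfl,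
    ⟨DynLift.pTildeStrongMonoidal J⟩⟩
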